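/- **Setting.** Let $\mathbb T^n=(\mathbb R/\mathbb Z)^n$ carry its normalized Haar measure. For functions on $\mathbb Z^n$ put $\Delta_{k_j}f(k)=f(k+e_j)-f(k)$ and $\Delta_k^\alpha=\Delta_{k_1}^{\alpha_1}\cdots\Delta_{k_n}^{\alpha_n}$; for functions on $\mathbb T^n$ put $D_{x_j}=\frac1{2\pi i}\frac{\partial}{\partial x_j}$, $D_{x_j}^{(\ell)}=\prod_{r=0}^{\ell-1}(D_{x_j}-r)$ (so $D_{x_j}^{(0)}=I$) and $D_x^{(\beta)}=D_{x_1}^{(\beta_1)}\cdots D_{x_n}^{(\beta_n)}$, where $\alpha,\beta\in\mathbb N_0^n$. A function $\Lambda:\mathbb Z^n\to\mathbb R$ is a *weight function* of order $\mu$ if there are constants $0<\mu_0\le\mu_1\le\mu$ and $C_0,C_1>0$ with $C_0(1+|k|)^{\mu_0}\le\Lambda(k)\le C_1(1+|k|)^{\mu_1}$ for all $k$, and if for all $\alpha\in\mathbb N_0^n$ and $\gamma\in\{0,1\}^n$ there is a constant $C_{\alpha,\gamma}>0$ with $|k^\gamma\Delta_k^{\alpha+\gamma}\Lambda(k)|\le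 C_{\alpha,\gamma}\Lambda(k)^{1-|\alpha|/\mu}$ for all $k\in\mathbb Z^n$. Let $m\in\mathbb R$ and $0<\rho\le 1/\mu$. The class $S^m_{\rho,\Lambda}$ consists of all $\sigma:\mathbb Z^n\times\mathbb T^n\to\mathbb C$ that are $C^\infty$ in $x$ for each $k$ and satisfy, for all $\alpha,\beta\in\mathbb N_0^n$, an estimate $|D_x^{(\beta)}\Delta_k^\alpha\sigma(k,x)|\le C_{\alpha,\beta}\Lambda(k)^{m-\rho|\alpha|}$ for all $(k,x)$. The class $M^m_{\rho,\Lambda}$ consists of all $\sigma$ that are $C^\infty$ in $x$ for each $k$ and such that $k^\gamma\Delta_k^\gamma\sigma(k,x)\in S^m_{\rho,\Lambda}$ for every $\gamma\in\{0,1\}^n$. For a symbol $\sigma$ let $$(T_\sigma f)(k)=\int_{\mathbb T^n}e^{2\pi i k\cdot x}\sigma(k,x)\widehat f(x)\,dx,\qquad \widehat f(x)=\sum_{k\in\mathbb Z^n}e^{-2\pi i k\cdot x}f(k),\qquad f\in\ell^2(\mathbb Z^n),$$ where the series defining $\widehat f$ converges in $L^2(\mathbb T^n)$. Let $\mathcal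 S(\mathbb Z^n)$ be the space of rapidly decreasing functions on $\mathbb Z^n$ and $\langle f,g\rangle=\sum_k f(k)\overline{g(k)}$. **Theorem.** Let $\Lambda$ be a weight function of order $\mu$ on $\mathbb Z^n$, $0<\rho\le1/\mu$, $m\in\mathbb R$ and $\sigma\in M^m_{\rho,\Lambda}$. Then there is a symbol $\sigma^*\in M^m_{\rho,\Lambda}$ such that the $\ell^2$-adjoint of $T_\sigma$ is the pseudo-difference operator $T_{\sigma^*}$, in the following sense: 1. $T_\sigma$ and $T_{\sigma^*}$ map $\mathcal S(\mathbb Z^n)$ into itself, and $\langle T_\sigma f,g\rangle=\langle f,T_{\sigma^*}g\rangle$ for all $f,g\in\mathcal S(\mathbb Z^n)$. 2. If $T_\sigma$ is regarded as an operator in $\ell^2(\mathbb Z^n)$ with domain $\mathcal S(\mathbb Z^n)$, then its Hilbert space adjoint $T_\sigma^*$ has domain $\{g\in\ell^2(\mathbb Z^n):T_{\sigma^*}g\in\ell^2(\mathbb Z^n)\}$ and equals $T_{\sigma^*}$ there. That is, for $g,h\in\ell^2(\mathbb Z^n)$ one has $\langle T_\sigma f,g\rangle=\langle f,h\rangle$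 for all $f\in\mathcal S(\mathbb Z^n)$ if and only if $T_{\sigma^*}g=h$. Moreover $\sigma^*(k,x)\sim\sum_{\alpha}\frac1{\alpha!}\Delta_k^\alpha D_x^{(\alpha)}\overline{\sigma(k,x)}$, which means that for every integer $N\ge0$ $$\sigma^*(k,x)-\sum_{|\alpha|<N}\frac1{\alpha!}\Delta_k^\alpha D_x^{(\alpha)}\overline{\sigma(k,x)}\in M^{m-\rho N}_{\rho,\Lambda}.$$ -/

import Mathlib

namespace LatticePDO

open MeasureTheory
open scoped ComplexConjugate ContDiff

noncomputable section

/-- The lattice `ℤⁿ`. -/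
abbrev Lattice (n : ℕ) := Fin n → ℤ

/-- The torus `𝕋ⁿ = (ℝ/ℤ)ⁿ`. -/
abbrev Torus (n : ℕ) := UnitAddTorus (Fin n)

/-- Multi-indices, i.e. elements of `ℕ₀ⁿ`. -/
abbrev MultiIdx (n : ℕ) := Fin n → ℕ

/-- Functions `ℤⁿ × 𝕋ⁿ → ℂ`. -/
abbrev Symb (n : ℕ) := Lattice n → Torus n → ℂ

/-- The Hilbert space `ℓ²(ℤⁿ)`. -/
abbrev L2Lattice (n : ℕ) := lp (fun _ : Lattice n => ℂ) 2

/-- The Euclidean length `|k|` of a lattice point. -/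
def latticeNorm {n : ℕ} (k : Lattice n) : ℝ := Real.sqrt (∑ i, (k i : ℝ) ^ 2)

/-- `|α| = α₁ + ⋯ + αₙ`. -/
def MultiIdx.order {n : ℕ} (α : MultiIdx n) : ℕ := ∑ i, α i

/-- `α! = α₁! ⋯ αₙ!`. -/
def MultiIdx.fact {n : ℕ} (α : MultiIdx n) : ℕ := ∏ i, (α i).factorial

/-- The set `{0,1}ⁿ` of multi-indices. -/
def MultiIdx.IsZeroOne {n : ℕ} (γ : MultiIdx n) : Prop := ∀ i, γ i ≤ 1

/-- The monomial `k^γ = k₁^γ₁ ⋯ kₙ^γₙ`. -/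
def monomial {n : ℕ} (γ : MultiIdx n) (k : Lattice n) : ℤ := ∏ i, k i ^ γ i

/-- The composition `op₁ ∘ op₂ ∘ ⋯ ∘ opₙ` of a family of operators. -/
def composeAll {n : ℕ} {F : Type*} (op : Fin n → F → F) (f : F) : F :=
  (List.finRange n).foldr (fun j g => op j g) f

/-- The forward difference `(Δ_{k_j} f)(k) = f(k + e_j) - f(k)`. -/
def diffOne {n : ℕ} {E : Type*} [AddCommGroup E] (j : Fin n) (f : Lattice n → E) :
    Lattice n → E :=
  fun k => f (k + Pi.single j 1) - f k

/-- The difference operator `Δ_k^α = Δ_{k_1}^{α_1} ⋯ Δ_{k_n}^{α_n}`. For a symbol take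
`E = 𝕋ⁿ → ℂ`, so that the differences are taken in `k` for each fixed `x`. -/
def diff {n : ℕ} {E : Type*} [AddCommGroup E] (α : MultiIdx n) (f : Lattice n → E) :
    Lattice n → E :=
  composeAll (fun j g => (diffOne j)^[α j] g) f

/-- Smoothness of a function on the torus: its periodic lift to `ℝⁿ` is `C^∞`. -/
def TorusSmooth {n : ℕ} (u : Torus n → ℂ) : Prop :=
  ContDiff ℝ ∞ (fun y : Fin n → ℝ => u (fun i => (y i : UnitAddCircle)))

/-- `D_{x_j} = (2πi)⁻¹ ∂/∂x_j` on functions on the torus. -/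
def dOne {n : ℕ} (j : Fin n) (u : Torus n → ℂ) : Torus n → ℂ :=
  fun x => (2 * Real.pi * Complex.I)⁻¹ *
    deriv (fun t : ℝ => u (x + Pi.single j (t : UnitAddCircle))) 0

/-- `D_{x_j}^{(ℓ)} = ∏_{r=0}^{ℓ-1} (D_{x_j} - r)`, with `D_{x_j}^{(0)} = I`. -/
def dFallOne {n : ℕ} (j : Fin n) : ℕ → (Torus n → ℂ) → (Torus n → ℂ)
  | 0, u => u
  | ℓ + 1, u => fun x => dOne j (dFallOne j ℓ u) x - (ℓ : ℂ) * dFallOne j ℓ u x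

/-- `D_x^{(β)} = D_{x_1}^{(β_1)} ⋯ D_{x_n}^{(β_n)}`. -/
def dFall {n : ℕ} (β : MultiIdx n) (u : Torus n → ℂ) : Torus n → ℂ :=
  composeAll (fun j v => dFallOne j (β j) v) u

/-- `Λ` is a weight function on `ℤⁿ` of order `μ`. -/
def IsWeight {n : ℕ} (μ : ℝ) (Λ : Lattice n → ℝ) : Prop :=
  (∃ μ₀ μ₁ C₀ C₁ : ℝ, 0 < μ₀ ∧ μ₀ ≤ μ₁ ∧ μ₁ ≤ μ ∧ 0 < C₀ ∧ 0 < C₁ ∧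
    ∀ k, C₀ * (1 + latticeNorm k) ^ μ₀ ≤ Λ k ∧ Λ k ≤ C₁ * (1 + latticeNorm k) ^ μ₁) ∧
  ∀ α γ : MultiIdx n, γ.IsZeroOne → ∃ C : ℝ, 0 < C ∧ ∀ k,
    |(monomial γ k : ℝ) * diff (α + γ) Λ k| ≤ C * Λ k ^ (1 - (1 / μ) * (α.order : ℝ))

/-- The symbol class `S^m_{ρ,Λ}(ℤⁿ × 𝕋ⁿ)`. -/
def SymbolS {n : ℕ} (Λ : Lattice n → ℝ) (ρ m : ℝ) (σ : Symb n) : Prop :=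
  (∀ k, TorusSmooth (σ k)) ∧
  ∀ α β : MultiIdx n, ∃ C : ℝ, 0 < C ∧ ∀ k x,
    ‖dFall β (diff α σ k) x‖ ≤ C * Λ k ^ (m - ρ * (α.order : ℝ))

/-- The symbol class `M^m_{ρ,Λ}(ℤⁿ × 𝕋ⁿ)`. -/
def SymbolM {n : ℕ} (Λ : Lattice n → ℝ) (ρ m : ℝ) (σ : Symb n) : Prop :=
  (∀ k, TorusSmooth (σ k)) ∧
  ∀ γ : MultiIdx n, γ.IsZeroOne →
    SymbolS Λ ρ m (fun k x => (monomial γ k : ℂ) * diff γ σ k x)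

/-- The normalized Haar measure on the torus. -/
def torusMeasure (n : ℕ) : Measure (Torus n) :=
  Measure.pi (fun _ : Fin n => (AddCircle.haarAddCircle : Measure UnitAddCircle))

/-- The Fourier transform `f̂(x) = ∑_k e^{-2πi k·x} f(k)` of `f ∈ ℓ²(ℤⁿ)`, the series being
understood in `L²(𝕋ⁿ)`. The inverse of Mathlib's `mFourierBasis.repr` sends `f` to the sum of
`f(k) e^{2πi k·x}`, whence the reflection. -/
def latticeFourier {n : ℕ} (f : L2Lattice n) : Torus n → ℂ :=
  fun x => ((UnitAddTorus.mFourierBasis (d := Fin n)).repr.symm f : Torus n → ℂ) (-x)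

/-- The pseudo-difference operator
`(T_σ f)(k) = ∫_{𝕋ⁿ} e^{2πi k·x} σ(k,x) f̂(x) dx`. -/
def pdo {n : ℕ} (σ : Symb n) (f : L2Lattice n) : Lattice n → ℂ :=
  fun k => ∫ x, UnitAddTorus.mFourier k x * σ k x * latticeFourier f x ∂(torusMeasure n)

/-- Membership in the Schwartz space `𝒮(ℤⁿ)` of rapidly decreasing functions. -/
def RapidDecay {n : ℕ} (f : Lattice n → ℂ) : Prop :=
  ∀ N : ℕ, ∃ C : ℝ, ∀ k, (1 + latticeNorm k) ^ N * ‖f k‖ ≤ C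

/-- The `ℓ²` pairing `⟨f, g⟩ = ∑_k f(k) conj(g(k))`. -/
def l2Pairing {n : ℕ} (f g : Lattice n → ℂ) : ℂ := ∑' k, f k * conj (g k)

/-- `T_σ` is regarded as an operator in `ℓ²(ℤⁿ)` with domain `𝒮(ℤⁿ)`. For `g, h ∈ ℓ²(ℤⁿ)` this
says that `g` belongs to the domain of its Hilbert space adjoint `T_σ^*` and `T_σ^* g = h`. -/
def IsAdjointValue {n : ℕ} (σ : Symb n) (g h : L2Lattice n) : Prop :=
  ∀ f : L2Lattice n, RapidDecay f → l2Pairing (pdo σ f) g = l2Pairing f h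

/-- The partial sum `∑_{|α| < N} (1/α!) Δ_k^α D_x^{(α)} conj(σ(k,x))`. -/
def adjointExpansion {n : ℕ} (σ : Symb n) (N : ℕ) : Symb n := fun k x =>
  ∑ α ∈ (Fintype.piFinset (fun _ : Fin n => Finset.range N)).filter
      (fun α : MultiIdx n => α.order < N),
    (1 / (α.fact : ℂ)) * diff α (fun l => dFall α (fun y => conj (σ l y))) k x

end

end LatticePDO

namespace LatticePDO

open MeasureTheory
open scoped ComplexConjugate ContDiff

/-! ### Multi-indices and the algebra of difference operators. -/

noncomputable section

/-! Everything is read off from the Fourier coefficients `b(k, ξ)` of `σ(k, ·)`. The matrix of `T_σ`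
is `b(k, l - k)`, so its conjugate transpose is again the matrix of a symbol, with coefficients `c(k
+ ξ, ξ)`, where `c(k, ξ) = conj b(k, -ξ)` are the coefficients of `conj σ`. Expanding `c(k + ξ, ξ)`
about `k` by Newton's forward-difference formula gives the terms `ξ^{(β)}/β! · Δ^β c(k, ξ)`. Since
`D_x^{(β)}` multiplies the coefficients by `ξ^{(β)}`, these are exactly the terms of the asymptotic
expansion, and the error is exactly the Newton remainder.

The remainder of order `N` involves only differences of order `N` at points `k + η` with `η` no
longer than `ξ` (`mul_norm_taylorRem_le`). Three facts bring the estimate back to `k` at the price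
of powers of `1 + |ξ|`, which the rapid decay in `ξ` pays for: powers of `Λ` are temperate
(`IsWeight.exists_rpow_shift_le`), the monomials `k^γ` are comparable with those at `k + η`
(`norm_monomial_ind_le`), and the condition defining `M` may be stated with the monomial outside all
differences (`CoefM.of_coefS`, `CoefM.coefS`). The result is `CoefM.taylorCoef`; its case `N = 0`
shows that the adjoint symbol itself is in the class.

On the operator side, the matrix decays rapidly off the diagonal and grows polynomially along it, so
the double sum for the pairing converges absolutely when `f` is rapidly decreasing and `g` is merely
bounded. Hence the adjoint identity holds for every `g` in `ℓ²`, and testing it on point masses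
determines the adjoint and its domain. -/

theorem MultiIdx.induction {n : ℕ} {P : MultiIdx n → Prop} (zero : P 0)
    (succ : ∀ α j, P α → P (α + Pi.single j 1)) (α : MultiIdx n) : P α := by
  induction h : ∑ i, α i generalizing α with
  | zero =>
    have : α = 0 := by
      funext i
      exact (Finset.sum_eq_zero_iff.mp h) i (Finset.mem_univ i)
    rwa [this]
  | succ N ih =>
    obtain ⟨j, hj⟩ : ∃ j, α j ≠ 0 := by
      by_contra! hc
      simp [hc] at h
    have hle : Pi.single j 1 ≤ α := by
      intro i
      rcases eq_or_ne i j with rfl | hi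
      · simp; omega
      · simp [hi]
    have he : α - Pi.single j 1 + Pi.single j 1 = α := tsub_add_cancel_of_le hle
    rw [← he]
    refine succ _ _ (ih _ ?_)
    have : ∑ i, (α - Pi.single j 1 + Pi.single j 1 : MultiIdx n) i = N + 1 := by rw [he, h]
    simpa [Finset.sum_add_distrib] using this

theorem MultiIdx.order_add {n : ℕ} (α β : MultiIdx n) :
    (α + β).order = α.order + β.order := Finset.sum_add_distrib

@[simp] theorem MultiIdx.order_zero {n : ℕ} : (0 : MultiIdx n).order = 0 := by
  simp [MultiIdx.order]

@[simp] theorem MultiIdx.order_single {n : ℕ} (j : Fin n) (a : ℕ) :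
    MultiIdx.order (Pi.single j a) = a := by
  simp [MultiIdx.order]

section Diff

variable {n : ℕ} {E F : Type*} [AddCommGroup E] [AddCommGroup F]

theorem diffOne_commute (i j : Fin n) :
    Function.Commute (diffOne (E := E) i) (diffOne (E := E) j) := by
  intro f
  funext k
  simp only [diffOne, add_right_comm k (Pi.single j 1)]
  abel

theorem iterate_diffOne_foldr (i : Fin n) (a : ℕ) (l : List (Fin n)) (α : MultiIdx n)
    (f : Lattice n → E) :
    (diffOne i)^[a] (l.foldr (fun j g => (diffOne j)^[α j] g) f) =
      l.foldr (fun j g => (diffOne j)^[α j] g) ((diffOne i)^[a] f) := by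
  induction l with
  | nil => rfl
  | cons j l ih =>
    simp only [List.foldr_cons]
    rw [((diffOne_commute i j).iterate_iterate a (α j)).eq, ih]

theorem foldr_diffOne_add (l : List (Fin n)) (α β : MultiIdx n) (f : Lattice n → E) :
    l.foldr (fun j g => (diffOne j)^[(α + β) j] g) f =
      l.foldr (fun j g => (diffOne j)^[α j] g) (l.foldr (fun j g => (diffOne j)^[β j] g) f) := by
  induction l with
  | nil => rfl
  | cons j l ih =>
    simp only [List.foldr_cons]
    rw [ih, Pi.add_apply, Function.iterate_add_apply, iterate_diffOne_foldr j (β j) l α]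

theorem foldr_diffOne_single (l : List (Fin n)) (hl : l.Nodup) (i : Fin n) (f : Lattice n → E) :
    l.foldr (fun j g => (diffOne j)^[(Pi.single i 1 : MultiIdx n) j] g) f =
      if i ∈ l then diffOne i f else f := by
  induction l with
  | nil => rfl
  | cons j l ih =>
    rw [List.nodup_cons] at hl
    simp only [List.foldr_cons]
    rw [ih hl.2]
    rcases eq_or_ne j i with rfl | hji
    · simp [hl.1]
    · simp [hji, hji.symm]

theorem diff_add (α β : MultiIdx n) (f : Lattice n → E) :
    diff (α + β) f = diff α (diff β f) :=
  foldr_diffOne_add _ α β f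

@[simp] theorem diff_zero (f : Lattice n → E) : diff 0 f = f := by
  unfold diff composeAll
  induction List.finRange n with
  | nil => rfl
  | cons j l ih => simp

@[simp] theorem diff_single (i : Fin n) (f : Lattice n → E) :
    diff (Pi.single i 1) f = diffOne i f := by
  unfold diff composeAll
  rw [foldr_diffOne_single _ (List.nodup_finRange n)]
  simp

theorem diff_succ (α : MultiIdx n) (j : Fin n) (f : Lattice n → E) :
    diff (α + Pi.single j 1) f = diffOne j (diff α f) := by
  rw [add_comm, diff_add, diff_single]

theorem diff_mem {P : E → Prop} (hP : ∀ u v, P u → P v → P (u - v)) (α : MultiIdx n)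
    {f : Lattice n → E} (hf : ∀ k, P (f k)) (k : Lattice n) : P (diff α f k) := by
  induction α using MultiIdx.induction generalizing k with
  | zero => simpa using hf k
  | succ α j ih =>
    rw [diff_succ]
    exact hP _ _ (ih _) (ih _)

/-- The predicate `P` allows maps that are additive only on a subclass: `coef` respects differences
of smooth functions, not of arbitrary ones. -/
theorem map_diff {P : E → Prop} (hP : ∀ u v, P u → P v → P (u - v)) {L : E → F}
    (hL : ∀ u v, P u → P v → L (u - v) = L u - L v) (α : MultiIdx n)
    {f : Lattice n → E} (hf : ∀ k, P (f k)) (k : Lattice n) :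
    L (diff α f k) = diff α (fun l => L (f l)) k := by
  induction α using MultiIdx.induction generalizing k with
  | zero => simp
  | succ α j ih =>
    rw [diff_succ, diff_succ]
    simp only [diffOne]
    rw [hL _ _ (diff_mem hP α hf _) (diff_mem hP α hf _), ih, ih]

theorem map_diff' {L : E → F} (hL : ∀ u v, L (u - v) = L u - L v) (α : MultiIdx n)
    (f : Lattice n → E) (k : Lattice n) :
    L (diff α f k) = diff α (fun l => L (f l)) k :=
  map_diff (P := fun _ => True) (fun _ _ _ _ => trivial) (fun u v _ _ => hL u v) α
    (fun _ => trivial) k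

theorem diff_apply {X : Type*} (α : MultiIdx n) (f : Lattice n → X → E) (k : Lattice n) (x : X) :
    diff α f k x = diff α (fun l => f l x) k :=
  map_diff' (L := fun u : X → E => u x) (fun _ _ => rfl) α f k

theorem diff_shift (α : MultiIdx n) (f : Lattice n → E) (η k : Lattice n) :
    diff α (fun l => f (l + η)) k = diff α f (k + η) := by
  induction α using MultiIdx.induction generalizing k with
  | zero => simp
  | succ α j ih =>
    rw [diff_succ, diff_succ]
    simp only [diffOne, ih, add_right_comm]

theorem diff_sub (α : MultiIdx n) (f g : Lattice n → E) (k : Lattice n) :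
    diff α (fun l => f l - g l) k = diff α f k - diff α g k := by
  induction α using MultiIdx.induction generalizing k with
  | zero => simp
  | succ α j ih =>
    simp only [diff_succ, diffOne, ih]
    abel

theorem diff_add_fun (α : MultiIdx n) (f g : Lattice n → E) (k : Lattice n) :
    diff α (fun l => f l + g l) k = diff α f k + diff α g k := by
  induction α using MultiIdx.induction generalizing k with
  | zero => simp
  | succ α j ih =>
    simp only [diff_succ, diffOne, ih]
    abel

theorem diff_zero_fun (α : MultiIdx n) (k : Lattice n) :
    diff α (fun _ : Lattice n => (0 : E)) k = 0 := by
  have := diff_sub α (fun _ : Lattice n => (0 : E)) (fun _ => 0) k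
  rwa [sub_self, sub_self] at this

theorem diff_sum {ι : Type*} (s : Finset ι) (α : MultiIdx n) (f : ι → Lattice n → E)
    (k : Lattice n) :
    diff α (fun l => ∑ i ∈ s, f i l) k = ∑ i ∈ s, diff α (f i) k := by
  classical
  induction s using Finset.induction_on with
  | empty => simpa using diff_zero_fun α k
  | insert i s hi ih => simp only [Finset.sum_insert hi, diff_add_fun, ih]

theorem diff_const_mul (α : MultiIdx n) (c : ℂ) (f : Lattice n → ℂ) (k : Lattice n) :
    diff α (fun l => c * f l) k = c * diff α f k :=
  (map_diff' (L := fun z : ℂ => c * z) (fun _ _ => mul_sub _ _ _) α f k).symm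

end Diff

/-- The multi-index in `{0,1}ⁿ` supported on `s`. -/
def ind {n : ℕ} (s : Finset (Fin n)) : MultiIdx n := fun i => if i ∈ s then 1 else 0

theorem isZeroOne_ind {n : ℕ} (s : Finset (Fin n)) : (ind s).IsZeroOne := by
  intro i
  unfold ind
  split_ifs <;> simp

theorem exists_ind_eq {n : ℕ} {γ : MultiIdx n} (hγ : γ.IsZeroOne) : ∃ s, γ = ind s := by
  refine ⟨Finset.univ.filter fun i => γ i = 1, ?_⟩
  funext i
  have := hγ i
  by_cases h : γ i = 1
  · simp [ind, h]
  · simp [ind, h]; omega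

@[simp] theorem ind_empty {n : ℕ} : ind (∅ : Finset (Fin n)) = 0 := by
  funext i; simp [ind]

theorem ind_insert {n : ℕ} {s : Finset (Fin n)} {j : Fin n} (hj : j ∉ s) :
    ind (insert j s) = ind s + Pi.single j 1 := by
  funext i
  rcases eq_or_ne i j with rfl | h
  · simp [ind, hj]
  · simp [ind, h]

theorem ind_sdiff_add {n : ℕ} {s t : Finset (Fin n)} (h : t ⊆ s) :
    ind (s \ t) + ind t = ind s := by
  funext i
  simp only [ind, Pi.add_apply, Finset.mem_sdiff]
  by_cases h1 : i ∈ t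
  · simp [h1, h h1]
  · simp [h1]

theorem monomial_ind {n : ℕ} (s : Finset (Fin n)) (k : Lattice n) :
    monomial (ind s) k = ∏ i ∈ s, k i := by
  simp [monomial, ind]

end

/-! ### The weight `1 + |k|`, summability, and falling factorials. -/

noncomputable section

/-- The weight `1 + |k|`. -/
def jb {n : ℕ} (k : Lattice n) : ℝ := 1 + latticeNorm k

section Bracket

variable {n : ℕ}

theorem latticeNorm_eq_norm (k : Lattice n) :
    latticeNorm k = ‖(WithLp.toLp 2 (fun i => (k i : ℝ)) : EuclideanSpace ℝ (Fin n))‖ := by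
  simp [latticeNorm, EuclideanSpace.norm_eq]

theorem latticeNorm_nonneg (k : Lattice n) : 0 ≤ latticeNorm k := Real.sqrt_nonneg _

theorem latticeNorm_add_le (k l : Lattice n) :
    latticeNorm (k + l) ≤ latticeNorm k + latticeNorm l := by
  simp only [latticeNorm_eq_norm]
  refine le_trans (le_of_eq ?_) (norm_add_le _ _)
  congr 1
  ext i
  simp

@[simp] theorem latticeNorm_neg (k : Lattice n) : latticeNorm (-k) = latticeNorm k := by
  simp [latticeNorm]

theorem abs_le_latticeNorm (k : Lattice n) (i : Fin n) : |(k i : ℝ)| ≤ latticeNorm k := by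
  rw [latticeNorm_eq_norm]
  exact PiLp.norm_apply_le (WithLp.toLp 2 (fun i => (k i : ℝ)) : EuclideanSpace ℝ (Fin n)) i

theorem latticeNorm_le_sum (k : Lattice n) : latticeNorm k ≤ ∑ i, |(k i : ℝ)| := by
  have h0 : 0 ≤ ∑ i, |(k i : ℝ)| := Finset.sum_nonneg fun _ _ => abs_nonneg _
  rw [latticeNorm, Real.sqrt_le_left h0]
  simpa using Finset.sum_sq_le_sq_sum_of_nonneg (s := Finset.univ) (f := fun i => |(k i : ℝ)|)
    (fun _ _ => abs_nonneg _)

theorem one_le_jb (k : Lattice n) : 1 ≤ jb k := by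
  have := latticeNorm_nonneg k
  unfold jb; linarith

theorem jb_pos (k : Lattice n) : 0 < jb k := zero_lt_one.trans_le (one_le_jb k)

@[simp] theorem jb_neg (k : Lattice n) : jb (-k) = jb k := by simp [jb]

theorem jb_sub_comm (k l : Lattice n) : jb (k - l) = jb (l - k) := by
  rw [← jb_neg, neg_sub]

theorem jb_add_le (k l : Lattice n) : jb (k + l) ≤ jb k * jb l := by
  have := latticeNorm_add_le k l
  have := mul_nonneg (latticeNorm_nonneg k) (latticeNorm_nonneg l)
  unfold jb; nlinarith

theorem jb_le_mul_sub (k l : Lattice n) : jb k ≤ jb l * jb (k - l) := by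
  simpa using jb_add_le l (k - l)

theorem abs_le_jb (k : Lattice n) (i : Fin n) : |(k i : ℝ)| ≤ jb k := by
  have := abs_le_latticeNorm k i
  unfold jb; linarith

theorem one_add_abs_le_jb (k : Lattice n) (i : Fin n) : 1 + |(k i : ℝ)| ≤ jb k := by
  have := abs_le_latticeNorm k i
  unfold jb; linarith

theorem jb_le_one_add_sum (k : Lattice n) : jb k ≤ 1 + ∑ i, |(k i : ℝ)| := by
  have := latticeNorm_le_sum k
  unfold jb; linarith

theorem summable_inv_one_add_abs_sq : Summable fun a : ℤ => ((1 + |(a : ℝ)|) ^ 2)⁻¹ := by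
  have h := (Real.summable_one_div_int_pow (p := 2)).mpr one_lt_two
  refine (h.add (summable_of_hasFiniteSupport
    (f := fun a : ℤ => if a = 0 then (1 : ℝ) else 0) ?_)).of_nonneg_of_le
    (fun a => by positivity) fun a => ?_
  · exact (Set.finite_singleton (0 : ℤ)).subset fun a ha => by
      by_contra hc
      simp_all
  · rcases eq_or_ne a 0 with rfl | ha
    · simp
    · simp only [ha, if_false, add_zero, one_div]
      have ha' : (0 : ℝ) < (a : ℝ) ^ 2 := by positivity
      refine inv_anti₀ ha' ?_
      rw [← sq_abs]
      have := abs_nonneg (a : ℝ)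
      gcongr
      linarith

/-- Every finite set of points lies in a box, and over a box the sum of products factors. -/
theorem summable_prod_of_nonneg {ι : Type*} {g : ι → ℝ} (hg : Summable g) (h0 : ∀ a, 0 ≤ g a) :
    Summable fun k : Fin n → ι => ∏ i, g (k i) := by
  classical
  refine summable_of_sum_le (c := ∏ _i : Fin n, ∑' a, g a)
    (fun k => Finset.prod_nonneg fun i _ => h0 _) fun s => ?_
  calc ∑ k ∈ s, ∏ i, g (k i)
      ≤ ∑ k ∈ Fintype.piFinset fun i => s.image fun k => k i, ∏ i, g (k i) := by
        refine Finset.sum_le_sum_of_subset_of_nonneg (fun k hk => ?_)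
          fun k _ _ => Finset.prod_nonneg fun i _ => h0 _
        exact Fintype.mem_piFinset.mpr fun i => Finset.mem_image_of_mem _ hk
    _ = ∏ i : Fin n, ∑ a ∈ s.image fun k => k i, g a := (Finset.prod_univ_sum _ _).symm
    _ ≤ _ := Finset.prod_le_prod (fun i _ => Finset.sum_nonneg fun a _ => h0 a)
        fun i _ => hg.sum_le_tsum _ fun a _ => h0 a

theorem summable_inv_jb_pow : Summable fun k : Lattice n => (jb k ^ (2 * n))⁻¹ := by
  refine (summable_prod_of_nonneg (n := n) summable_inv_one_add_abs_sq
    fun a => by positivity).of_nonneg_of_le (fun k => by have := jb_pos k; positivity) fun k => ?_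
  rw [Finset.prod_inv_distrib]
  refine inv_anti₀ (Finset.prod_pos fun i _ => by positivity) ?_
  calc ∏ i, (1 + |(k i : ℝ)|) ^ 2 ≤ ∏ _i : Fin n, jb k ^ 2 := by
        refine Finset.prod_le_prod (fun i _ => by positivity) fun i _ => ?_
        have := one_add_abs_le_jb k i
        gcongr
    _ = jb k ^ (2 * n) := by simp [pow_mul]

theorem rapidDecay_iff {f : Lattice n → ℂ} :
    RapidDecay f ↔ ∀ N : ℕ, ∃ C : ℝ, ∀ k, jb k ^ N * ‖f k‖ ≤ C := Iff.rfl

theorem norm_le_of_jb_pow_mul_le {k : Lattice n} {N : ℕ} {a C : ℝ} (h : jb k ^ N * a ≤ C) :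
    a ≤ C * (jb k ^ N)⁻¹ := by
  rw [← div_eq_mul_inv, le_div_iff₀ (pow_pos (jb_pos k) N), mul_comm]
  exact h

theorem RapidDecay.summable_norm {f : Lattice n → ℂ} (hf : RapidDecay f) :
    Summable fun k => ‖f k‖ := by
  obtain ⟨C, hC⟩ := rapidDecay_iff.mp hf (2 * n)
  exact (summable_inv_jb_pow.mul_left C).of_nonneg_of_le (fun k => norm_nonneg _)
    fun k => norm_le_of_jb_pow_mul_le (hC k)

end Bracket

/-- The falling factorial `ξ^{(β)} = ∏ᵢ ξᵢ (ξᵢ - 1) ⋯ (ξᵢ - βᵢ + 1)`. -/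
def fall {n : ℕ} (β : MultiIdx n) (ξ : Lattice n) : ℂ :=
  ∏ i, ∏ r ∈ Finset.range (β i), ((ξ i : ℂ) - r)

section Fall

variable {n : ℕ}

@[simp] theorem fall_zero (ξ : Lattice n) : fall 0 ξ = 1 := by simp [fall]

theorem fall_succ (β : MultiIdx n) (j : Fin n) (ξ : Lattice n) :
    fall (β + Pi.single j 1) ξ = ((ξ j : ℂ) - β j) * fall β ξ := by
  unfold fall
  rw [← Finset.mul_prod_erase _ _ (Finset.mem_univ j),
    ← Finset.mul_prod_erase (a := j) (s := Finset.univ)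
      (f := fun i => ∏ r ∈ Finset.range (β i), ((ξ i : ℂ) - r)) (Finset.mem_univ j)]
  have : ∀ i ∈ Finset.univ.erase j,
      ∏ r ∈ Finset.range ((β + Pi.single j 1 : MultiIdx n) i), ((ξ i : ℂ) - r) =
      ∏ r ∈ Finset.range (β i), ((ξ i : ℂ) - r) := by
    intro i hi
    rw [Pi.add_apply, Pi.single_eq_of_ne (Finset.ne_of_mem_erase hi), add_zero]
  rw [Finset.prod_congr rfl this]
  simp only [Pi.add_apply, Pi.single_eq_same, Finset.prod_range_succ]
  ring

theorem exists_norm_fall_le (β : MultiIdx n) :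
    ∃ C : ℝ, 0 ≤ C ∧ ∀ ξ, ‖fall β ξ‖ ≤ C * jb ξ ^ β.order := by
  induction β using MultiIdx.induction with
  | zero => exact ⟨1, zero_le_one, fun ξ => by simp⟩
  | succ β j ih =>
    obtain ⟨C, hC0, hC⟩ := ih
    refine ⟨(1 + β j) * C, by positivity, fun ξ => ?_⟩
    rw [fall_succ, norm_mul, MultiIdx.order_add, MultiIdx.order_single, pow_succ]
    have h1 : ‖(ξ j : ℂ) - β j‖ ≤ (1 + β j) * jb ξ := by
      refine (norm_sub_le _ _).trans ?_
      have h2 := abs_le_jb ξ j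
      have h3 := one_le_jb ξ
      have h4 : (0 : ℝ) ≤ β j := by positivity
      simp only [Complex.norm_intCast, Complex.norm_natCast]
      nlinarith
    calc _ ≤ ((1 + β j) * jb ξ) * (C * jb ξ ^ β.order) := by
          have := hC ξ
          have := jb_pos ξ
          gcongr
      _ = _ := by ring

/-- Each power of `1 + |ξ|` is gained from `ξ_j ξ^{(β)} = ξ^{(β + e_j)} + β_j ξ^{(β)}`. This turns
bounds on all `D_x^{(β)}` into rapid decay of coefficients, with constants uniform in the parameter
`i`. -/
theorem exists_jb_pow_mul_le {ι : Type*} {b : ι → Lattice n → ℂ} {w : ι → ℝ}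
    (h : ∀ β : MultiIdx n, ∃ C : ℝ, ∀ i ξ, ‖fall β ξ * b i ξ‖ ≤ C * w i) (N : ℕ) :
    ∀ β : MultiIdx n, ∃ C : ℝ, ∀ i ξ, jb ξ ^ N * ‖fall β ξ * b i ξ‖ ≤ C * w i := by
  induction N with
  | zero => simpa using h
  | succ N ih =>
    intro β
    obtain ⟨C, hC⟩ := ih β
    choose D hD using fun j => ih (β + Pi.single j 1)
    refine ⟨C + ∑ j, (D j + β j * C), fun i ξ => ?_⟩
    have h1 : ∀ j, |(ξ j : ℝ)| * (jb ξ ^ N * ‖fall β ξ * b i ξ‖) ≤ (D j + β j * C) * w i := by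
      intro j
      have e : (ξ j : ℂ) * (fall β ξ * b i ξ) =
          fall (β + Pi.single j 1) ξ * b i ξ + β j * (fall β ξ * b i ξ) := by
        rw [fall_succ]; ring
      have e2 : |(ξ j : ℝ)| * ‖fall β ξ * b i ξ‖ ≤
          ‖fall (β + Pi.single j 1) ξ * b i ξ‖ + β j * ‖fall β ξ * b i ξ‖ := by
        rw [← Complex.norm_intCast, ← norm_mul, e]
        refine (norm_add_le _ _).trans (le_of_eq ?_)
        rw [norm_mul (β j : ℂ), Complex.norm_natCast]
      calc |(ξ j : ℝ)| * (jb ξ ^ N * ‖fall β ξ * b i ξ‖)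
          = jb ξ ^ N * (|(ξ j : ℝ)| * ‖fall β ξ * b i ξ‖) := by ring
        _ ≤ jb ξ ^ N * (‖fall (β + Pi.single j 1) ξ * b i ξ‖ + β j * ‖fall β ξ * b i ξ‖) := by
            have := jb_pos ξ
            gcongr
        _ = jb ξ ^ N * ‖fall (β + Pi.single j 1) ξ * b i ξ‖ +
              β j * (jb ξ ^ N * ‖fall β ξ * b i ξ‖) := by ring
        _ ≤ D j * w i + β j * (C * w i) :=
            add_le_add (hD j i ξ) (mul_le_mul_of_nonneg_left (hC i ξ) (Nat.cast_nonneg _))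
        _ = _ := by ring
    have h0 : 0 ≤ jb ξ ^ N * ‖fall β ξ * b i ξ‖ := by
      have := jb_pos ξ
      positivity
    calc jb ξ ^ (N + 1) * ‖fall β ξ * b i ξ‖
        = jb ξ * (jb ξ ^ N * ‖fall β ξ * b i ξ‖) := by ring
      _ ≤ (1 + ∑ j, |(ξ j : ℝ)|) * (jb ξ ^ N * ‖fall β ξ * b i ξ‖) := by
          gcongr
          exact jb_le_one_add_sum ξ
      _ = jb ξ ^ N * ‖fall β ξ * b i ξ‖ +
            ∑ j, |(ξ j : ℝ)| * (jb ξ ^ N * ‖fall β ξ * b i ξ‖) := by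
          rw [add_mul, one_mul, Finset.sum_mul]
      _ ≤ C * w i + ∑ j, (D j + β j * C) * w i :=
          add_le_add (hC i ξ) (Finset.sum_le_sum fun j _ => h1 j)
      _ = _ := by rw [add_mul, Finset.sum_mul]

end Fall

end

/-! ### Temperateness of weight functions. -/

noncomputable section

/-- The `ℓ¹` length of a lattice point. -/
def l1 {n : ℕ} (η : Lattice n) : ℕ := ∑ i, (η i).natAbs

section LatticeInduction

variable {n : ℕ}

@[simp] theorem l1_zero : l1 (0 : Lattice n) = 0 := by simp [l1]

theorem l1_le_mul_jb (η : Lattice n) : (l1 η : ℝ) ≤ n * jb η := by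
  unfold l1
  push_cast
  calc ∑ i, ((η i).natAbs : ℝ) ≤ ∑ _i : Fin n, jb η := by
        refine Finset.sum_le_sum fun i _ => ?_
        rw [Nat.cast_natAbs, Int.cast_abs]
        exact abs_le_jb η i
    _ = n * jb η := by simp

theorem l1_succ_of_pos (η : Lattice n) (j : Fin n) (h : 0 ≤ η j) :
    l1 (η + Pi.single j 1) = l1 η + 1 := by
  unfold l1
  rw [← Finset.add_sum_erase _ _ (Finset.mem_univ j), ← Finset.add_sum_erase Finset.univ
    (fun i => (η i).natAbs) (Finset.mem_univ j)]
  have : ∀ i ∈ Finset.univ.erase j,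
      ((η + Pi.single j 1 : Lattice n) i).natAbs = (η i).natAbs := by
    intro i hi
    rw [Pi.add_apply, Pi.single_eq_of_ne (Finset.ne_of_mem_erase hi), add_zero]
  rw [Finset.sum_congr rfl this]
  simp only [Pi.add_apply, Pi.single_eq_same]
  omega

theorem l1_neg (η : Lattice n) : l1 (-η) = l1 η := by simp [l1]

theorem l1_of_neg (η : Lattice n) (j : Fin n) (h : η j < 0) :
    l1 η = l1 (η + Pi.single j 1) + 1 := by
  have := l1_succ_of_pos (-(η + Pi.single j 1)) j (by simp; omega)
  rw [l1_neg] at this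
  rw [← this, ← l1_neg η]
  congr 1
  abel

/-- A lattice point is reached from the origin by unit steps, each of which increases the `ℓ¹`
length. -/
theorem lattice_induction {P : Lattice n → Prop} (zero : P 0)
    (up : ∀ η j, l1 (η + Pi.single j 1) = l1 η + 1 → P η → P (η + Pi.single j 1))
    (down : ∀ η j, l1 η = l1 (η + Pi.single j 1) + 1 → P (η + Pi.single j 1) → P η)
    (η : Lattice n) : P η := by
  induction h : l1 η generalizing η with
  | zero =>
    have : η = 0 := by
      funext i
      simpa using (Finset.sum_eq_zero_iff.mp h) i (Finset.mem_univ i)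
    rwa [this]
  | succ N ih =>
    obtain ⟨j, hj⟩ : ∃ j, η j ≠ 0 := by
      by_contra! hc
      simp [l1, hc] at h
    rcases lt_or_gt_of_ne hj with hj | hj
    · have := l1_of_neg η j hj
      exact down η j this (ih _ (by omega))
    · have := l1_succ_of_pos (η - Pi.single j 1) j (by simp; omega)
      have e : η - Pi.single j 1 + Pi.single j 1 = η := sub_add_cancel _ _
      rw [← e]
      refine up _ j this (ih _ ?_)
      rw [e] at this
      omega

end LatticeInduction

section RpowStep

variable {a b C p : ℝ}

/-- Factor out `b` and use Bernoulli's inequality `(1 + t)^p ≤ 1 + pt`; the powers of `b` in the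
increment cancel. -/
theorem rpow_le_add_of_le_add (ha : 0 < a) (hb : 0 < b) (hC : 0 ≤ C) (hp : 0 < p) (hp1 : p ≤ 1)
    (h : a ≤ b + C * b ^ (1 - p)) : a ^ p ≤ b ^ p + C := by
  have e : b + C * b ^ (1 - p) = b * (1 + C * b ^ (-p)) := by
    rw [sub_eq_add_neg, Real.rpow_add hb, Real.rpow_one]; ring
  have h0 : 0 ≤ C * b ^ (-p) := by positivity
  calc a ^ p ≤ (b * (1 + C * b ^ (-p))) ^ p := by
        rw [← e]; exact Real.rpow_le_rpow ha.le h hp.le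
    _ = b ^ p * (1 + C * b ^ (-p)) ^ p := Real.mul_rpow hb.le (by linarith)
    _ ≤ b ^ p * (1 + p * (C * b ^ (-p))) := by
        gcongr
        exact rpow_one_add_le_one_add_mul_self (by linarith) hp.le hp1
    _ = b ^ p + p * C * (b ^ p * b ^ (-p)) := by ring
    _ = b ^ p + p * C := by rw [← Real.rpow_add hb, add_neg_cancel, Real.rpow_zero, mul_one]
    _ ≤ b ^ p + C := by nlinarith

/-- This serves a step taken backwards, where the increment is controlled by the value being
estimated. Unless `a ^ p` is already below `2 * C`, the increment is at most `a / 2`, so `a ≤ 2 * b`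
and the forward case applies with `2 * C`. -/
theorem rpow_le_add_of_le_add_self (ha : 0 < a) (hb : 0 < b) (hC : 0 ≤ C) (hp : 0 < p)
    (hp1 : p ≤ 1) (h : a ≤ b + C * a ^ (1 - p)) : a ^ p ≤ b ^ p + 2 * C := by
  rcases le_or_gt (2 * C) (a ^ p) with h1 | h1
  · have e : a ^ p * a ^ (1 - p) = a := by
      rw [← Real.rpow_add ha]; simp
    have h2 : 0 < a ^ (1 - p) := by positivity
    have h3 : 2 * C * a ^ (1 - p) ≤ a := by
      calc _ ≤ a ^ p * a ^ (1 - p) := by gcongr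
        _ = a := e
    have h4 : a ≤ 2 * b := by linarith
    have h5 : a ^ (1 - p) ≤ 2 * b ^ (1 - p) := by
      calc a ^ (1 - p) ≤ (2 * b) ^ (1 - p) := Real.rpow_le_rpow ha.le h4 (by linarith)
        _ = 2 ^ (1 - p) * b ^ (1 - p) := Real.mul_rpow (by norm_num) hb.le
        _ ≤ 2 ^ (1 : ℝ) * b ^ (1 - p) := by
            gcongr
            · norm_num
            · linarith
        _ = _ := by rw [Real.rpow_one]
    refine rpow_le_add_of_le_add ha hb (by linarith) hp hp1 ?_
    nlinarith
  · have : 0 ≤ b ^ p := by positivity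
    linarith

end RpowStep

section Weight

variable {n : ℕ} {μ : ℝ} {Λ : Lattice n → ℝ}

theorem IsWeight.order_pos (h : IsWeight μ Λ) : 0 < μ := by
  obtain ⟨⟨μ₀, μ₁, _, _, h1, h2, h3, _⟩, _⟩ := h
  linarith

theorem IsWeight.exists_le (h : IsWeight μ Λ) : ∃ c : ℝ, 0 < c ∧ ∀ k, c ≤ Λ k := by
  obtain ⟨⟨μ₀, μ₁, C₀, C₁, h1, h2, h3, hC₀, hC₁, hb⟩, _⟩ := h
  refine ⟨C₀, hC₀, fun k => le_trans ?_ (hb k).1⟩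
  have := Real.one_le_rpow (one_le_jb k) h1.le
  unfold jb at this
  nlinarith

theorem IsWeight.pos (h : IsWeight μ Λ) (k : Lattice n) : 0 < Λ k := by
  obtain ⟨c, hc, hb⟩ := h.exists_le
  exact hc.trans_le (hb k)

theorem IsWeight.exists_rpow_le (h : IsWeight μ Λ) {s t : ℝ} (hst : s ≤ t) :
    ∃ C : ℝ, 0 < C ∧ ∀ k, Λ k ^ s ≤ C * Λ k ^ t := by
  obtain ⟨c, hc, hb⟩ := h.exists_le
  refine ⟨c ^ (s - t), by positivity, fun k => ?_⟩
  have hk := h.pos k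
  calc Λ k ^ s = Λ k ^ (s - t) * Λ k ^ t := by rw [← Real.rpow_add hk]; simp
    _ ≤ _ := by
      gcongr ?_ * _
      exact Real.rpow_le_rpow_of_nonpos hc (hb k) (by linarith)

/-- The exponent is `p = min 1 (1 / μ)`: Bernoulli's inequality needs `p ≤ 1`, and lowering `1 / μ`
is harmless because `Λ` is bounded below. -/
theorem IsWeight.exists_abs_diffOne_le (h : IsWeight μ Λ) :
    ∃ C p : ℝ, 0 ≤ C ∧ 0 < p ∧ p ≤ 1 ∧ ∀ j k, |diffOne j Λ k| ≤ C * Λ k ^ (1 - p) := by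
  have hμ := h.order_pos
  obtain ⟨A, hA0, hA⟩ := h.exists_rpow_le (s := 1 - 1 / μ) (t := 1 - min 1 (1 / μ))
    (by have := min_le_right 1 (1 / μ); linarith)
  choose D hD0 hD using fun j : Fin n =>
    h.2 (Pi.single j 1) 0 (fun i => by simp)
  refine ⟨(∑ j, D j) * A, min 1 (1 / μ), ?_, by positivity, min_le_left _ _, fun j k => ?_⟩
  · exact mul_nonneg (Finset.sum_nonneg fun j _ => (hD0 j).le) hA0.le
  have h1 : D j ≤ ∑ j, D j :=
    Finset.single_le_sum (f := D) (fun j _ => (hD0 j).le) (Finset.mem_univ j)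
  have h2 : (0 : ℝ) ≤ Λ k ^ (1 - 1 / μ) := by have := h.pos k; positivity
  calc |diffOne j Λ k| ≤ D j * Λ k ^ (1 - 1 / μ) := by
        have := hD j k
        rw [add_zero, diff_single, MultiIdx.order_single] at this
        simpa [monomial] using this
    _ ≤ (∑ j, D j) * (A * Λ k ^ (1 - min 1 (1 / μ))) :=
        mul_le_mul h1 (hA k) h2 ((hD0 j).le.trans h1)
    _ = _ := by ring

/-- A unit step raises `Λ ^ p` by at most `2 * C`, so `Λ ^ p` is Lipschitz for the `ℓ¹` length; the
lower bound on `Λ` makes the additive estimate multiplicative. -/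
theorem IsWeight.exists_rpow_shift_le_linear (h : IsWeight μ Λ) :
    ∃ K p : ℝ, 0 < K ∧ 0 < p ∧ ∀ k η, Λ (k + η) ^ p ≤ K * Λ k ^ p * jb η := by
  obtain ⟨C, p, hC, hp, hp1, hd⟩ := h.exists_abs_diffOne_le
  obtain ⟨c, hc, hb⟩ := h.exists_le
  have key : ∀ k η, Λ (k + η) ^ p ≤ Λ k ^ p + 2 * C * l1 η := by
    intro k η
    induction η using lattice_induction with
    | zero => simp
    | up η j hl ih =>
      have h1 := (abs_le.mp (hd j (k + η))).2
      simp only [diffOne] at h1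
      have := rpow_le_add_of_le_add (h.pos (k + η + Pi.single j 1)) (h.pos (k + η)) hC hp hp1
        (by linarith)
      rw [hl, ← add_assoc]
      push_cast
      linarith
    | down η j hl ih =>
      have h1 := (abs_le.mp (hd j (k + η))).1
      simp only [diffOne] at h1
      have := rpow_le_add_of_le_add_self (h.pos (k + η)) (h.pos (k + η + Pi.single j 1)) hC hp hp1
        (by linarith)
      rw [hl]
      rw [← add_assoc] at ih
      push_cast
      linarith
  refine ⟨1 + 2 * C * n * (c ^ p)⁻¹, p, by positivity, hp, fun k η => (key k η).trans ?_⟩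
  have h1 : 1 ≤ (c ^ p)⁻¹ * Λ k ^ p := by
    rw [inv_mul_eq_div, one_le_div (by positivity)]
    exact Real.rpow_le_rpow hc.le (hb k) hp.le
  have h2 := l1_le_mul_jb η
  have h3 := one_le_jb η
  have h4 : 0 ≤ Λ k ^ p := by have := h.pos k; positivity
  calc Λ k ^ p + 2 * C * l1 η ≤ Λ k ^ p * jb η + 2 * C * (n * jb η) * ((c ^ p)⁻¹ * Λ k ^ p) := by
        refine add_le_add (le_mul_of_one_le_right h4 h3) ?_
        refine le_trans ?_ (le_mul_of_one_le_right (by positivity) h1)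
        gcongr
    _ = _ := by ring

/-- Powers of a weight function are temperate. -/
theorem IsWeight.exists_rpow_shift_le (h : IsWeight μ Λ) (s : ℝ) :
    ∃ (K : ℝ) (M : ℕ), 0 < K ∧ ∀ k η, Λ (k + η) ^ s ≤ K * Λ k ^ s * jb η ^ M := by
  obtain ⟨K, p, hK, hp, hb⟩ := h.exists_rpow_shift_le_linear
  have e : ∀ k s, Λ k ^ s = (Λ k ^ p) ^ (s / p) := fun k s => by
    rw [← Real.rpow_mul (h.pos k).le, mul_div_cancel₀ _ hp.ne']
  have main : ∀ t : ℝ, 0 ≤ t → ∀ k η, Λ (k + η) ^ t ≤ K ^ (t / p) * Λ k ^ t * jb η ^ ⌈t / p⌉₊ := by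
    intro t ht k η
    have h0 := h.pos k
    have h1 := h.pos (k + η)
    have h2 := jb_pos η
    rw [e k, e (k + η), ← Real.mul_rpow hK.le (by positivity)]
    calc _ ≤ (K * Λ k ^ p * jb η) ^ (t / p) :=
          Real.rpow_le_rpow (by positivity) (hb k η) (by positivity)
      _ = (K * Λ k ^ p) ^ (t / p) * jb η ^ (t / p) := Real.mul_rpow (by positivity) h2.le
      _ ≤ _ := by
        gcongr
        rw [← Real.rpow_natCast]
        exact Real.rpow_le_rpow_of_exponent_le (one_le_jb η) (Nat.le_ceil _)
  rcases le_total 0 s with hs | hs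
  · exact ⟨_, _, by positivity, main s hs⟩
  -- For negative exponents, apply the positive case to the base point `k + η` and the shift `-η`,
  -- then invert.
  · refine ⟨K ^ (-s / p), ⌈-s / p⌉₊, by positivity, fun k η => ?_⟩
    have h0 := h.pos k
    have h1 := h.pos (k + η)
    have := main (-s) (by linarith) (k + η) (-η)
    rw [add_neg_cancel_right, jb_neg, Real.rpow_neg h0.le, Real.rpow_neg h1.le] at this
    have h2 : 0 < Λ k ^ s := by positivity
    have h3 : 0 < Λ (k + η) ^ s := by positivity
    rw [inv_le_iff_one_le_mul₀ h2] at this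
    field_simp at this
    rw [neg_div]
    linarith

end Weight

end

/-! ### The symbol classes in terms of Fourier coefficients. -/

noncomputable section

/-- Families `b(k, ξ)`, such as the Fourier coefficients in `x` of a symbol `σ(k, x)`. -/
abbrev Coef (n : ℕ) := Lattice n → Lattice n → ℂ

/-- `b(k, ξ)` is `O(Λ(k)^m)`, with rapid decay in `ξ`. -/
def CoefBdd {n : ℕ} (Λ : Lattice n → ℝ) (m : ℝ) (b : Coef n) : Prop :=
  ∀ N : ℕ, ∃ C : ℝ, ∀ k ξ, jb ξ ^ N * ‖b k ξ‖ ≤ C * Λ k ^ m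

/-- Multiplication by `k^γ`, where `γ ∈ {0,1}ⁿ` has support `s`. -/
def cmul {n : ℕ} (s : Finset (Fin n)) (b : Coef n) : Coef n :=
  fun k ξ => (monomial (ind s) k : ℂ) * b k ξ

/-- The class `S^m_{ρ,Λ}` in terms of Fourier coefficients. -/
def CoefS {n : ℕ} (Λ : Lattice n → ℝ) (ρ m : ℝ) (b : Coef n) : Prop :=
  ∀ α : MultiIdx n, CoefBdd Λ (m - ρ * (α.order : ℝ)) (diff α b)

/-- The class `M^m_{ρ,Λ}` in terms of Fourier coefficients. -/
def CoefM {n : ℕ} (Λ : Lattice n → ℝ) (ρ m : ℝ) (b : Coef n) : Prop :=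
  ∀ (s : Finset (Fin n)) (α : MultiIdx n),
    CoefBdd Λ (m - ρ * (α.order : ℝ)) (cmul s (diff (α + ind s) b))

variable {n : ℕ} {Λ : Lattice n → ℝ} {ρ m m' μ : ℝ} {b c : Coef n}

theorem CoefBdd.add (hb : CoefBdd Λ m b) (hc : CoefBdd Λ m c) : CoefBdd Λ m (b + c) := by
  intro N
  obtain ⟨C, hC⟩ := hb N
  obtain ⟨D, hD⟩ := hc N
  refine ⟨C + D, fun k ξ => ?_⟩
  calc jb ξ ^ N * ‖b k ξ + c k ξ‖ ≤ jb ξ ^ N * (‖b k ξ‖ + ‖c k ξ‖) := by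
        have := jb_pos ξ
        gcongr
        exact norm_add_le _ _
    _ = jb ξ ^ N * ‖b k ξ‖ + jb ξ ^ N * ‖c k ξ‖ := by ring
    _ ≤ C * Λ k ^ m + D * Λ k ^ m := add_le_add (hC k ξ) (hD k ξ)
    _ = _ := by ring

theorem CoefBdd.neg (hb : CoefBdd Λ m b) : CoefBdd Λ m (-b) := by
  intro N
  obtain ⟨C, hC⟩ := hb N
  exact ⟨C, fun k ξ => by simpa using hC k ξ⟩

theorem CoefBdd.mono (hΛ : IsWeight μ Λ) (h : m ≤ m') (hb : CoefBdd Λ m b) : CoefBdd Λ m' b := by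
  intro N
  obtain ⟨C, hC⟩ := hb N
  obtain ⟨D, hD, hDb⟩ := hΛ.exists_rpow_le h
  refine ⟨|C| * D, fun k ξ => (hC k ξ).trans ?_⟩
  have h1 := hΛ.pos k
  calc C * Λ k ^ m ≤ |C| * Λ k ^ m := by
        gcongr
        exact le_abs_self C
    _ ≤ |C| * (D * Λ k ^ m') := by gcongr; exact hDb k
    _ = _ := by ring

theorem diff_fun_add {E : Type*} [AddCommGroup E] (α : MultiIdx n) (f g : Lattice n → E) :
    diff α (f + g) = diff α f + diff α g :=
  funext fun k => diff_add_fun α f g k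

theorem diff_fun_neg {E : Type*} [AddCommGroup E] (α : MultiIdx n) (f : Lattice n → E) :
    diff α (-f) = -diff α f :=
  funext fun k => (map_diff' (L := fun e : E => -e) (fun _ _ => by abel) α f k).symm

theorem CoefS.add (hb : CoefS Λ ρ m b) (hc : CoefS Λ ρ m c) : CoefS Λ ρ m (b + c) :=
  fun α => by
    rw [diff_fun_add]
    exact (hb α).add (hc α)

theorem CoefS.neg (hb : CoefS Λ ρ m b) : CoefS Λ ρ m (-b) :=
  fun α => by
    rw [diff_fun_neg]
    exact (hb α).neg

theorem CoefS.mono (hΛ : IsWeight μ Λ) (h : m ≤ m') (hb : CoefS Λ ρ m b) : CoefS Λ ρ m' b :=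
  fun α => (hb α).mono hΛ (by linarith)

theorem CoefS.diffOne (hb : CoefS Λ ρ m b) (j : Fin n) : CoefS Λ ρ (m - ρ) (diffOne j b) := by
  intro α
  have := hb (α + Pi.single j 1)
  rw [diff_add, diff_single, MultiIdx.order_add, MultiIdx.order_single] at this
  convert this using 1
  push_cast
  ring

theorem monomial_add_single_of_notMem {s : Finset (Fin n)} {j : Fin n} (hj : j ∉ s)
    (k : Lattice n) : monomial (ind s) (k + Pi.single j 1) = monomial (ind s) k := by
  rw [monomial_ind, monomial_ind]
  refine Finset.prod_congr rfl fun i hi => ?_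
  rw [Pi.add_apply, Pi.single_eq_of_ne (by rintro rfl; exact hj hi), add_zero]

theorem monomial_insert {s : Finset (Fin n)} {j : Fin n} (hj : j ∉ s) (k : Lattice n) :
    monomial (ind (insert j s)) k = k j * monomial (ind s) k := by
  rw [monomial_ind, monomial_ind, Finset.prod_insert hj]

theorem diffOne_cmul_of_notMem {s : Finset (Fin n)} {j : Fin n} (hj : j ∉ s) (b : Coef n) :
    diffOne j (cmul s b) = cmul s (diffOne j b) := by
  funext k ξ
  simp only [diffOne, cmul, Pi.sub_apply, monomial_add_single_of_notMem hj]
  ring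

/-- The discrete product rule for the factor `k_j`; the two correction terms carry the smaller
monomial. -/
theorem diffOne_cmul_insert {s : Finset (Fin n)} {j : Fin n} (hj : j ∉ s) (b : Coef n) :
    diffOne j (cmul (insert j s) b) =
      cmul (insert j s) (diffOne j b) + cmul s b + cmul s (diffOne j b) := by
  funext k ξ
  simp only [diffOne, cmul, Pi.sub_apply, Pi.add_apply, monomial_add_single_of_notMem hj,
    monomial_insert hj, Pi.single_eq_same]
  push_cast
  ring

/-- Solve the product rule for the term in which the monomial stays outside. A correction loses the
factor `k_j`, but the difference in direction `j` that accompanied it in `ind s` then counts towards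
`α`, so the order matches. Hence the induction on `s`, with an inner one on `α`. -/
theorem CoefM.of_coefS (hΛ : IsWeight μ Λ) (hρ : 0 < ρ)
    (h : ∀ s, CoefS Λ ρ m (cmul s (diff (ind s) b))) : CoefM Λ ρ m b := by
  have key : ∀ s, ∀ α : MultiIdx n,
      CoefS Λ ρ (m - ρ * (α.order : ℝ)) (cmul s (diff (α + ind s) b)) := by
    intro s
    induction s using Finset.strongInduction with
    | H s ihs =>
      intro α
      induction α using MultiIdx.induction with
      | zero => simpa using h s
      | succ α j ih =>
        have h1 := ih.diffOne j
        have e : m - ρ * (α.order : ℝ) - ρ = m - ρ * ((α + Pi.single j 1).order : ℝ) := by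
          rw [MultiIdx.order_add, MultiIdx.order_single]
          push_cast
          ring
        rw [e] at h1
        have e1 : diff (α + Pi.single j 1 + ind s) b = diffOne j (diff (α + ind s) b) := by
          rw [add_right_comm, diff_succ]
        rw [e1]
        by_cases hj : j ∈ s
        · obtain ⟨t, hjt, rfl⟩ : ∃ t, j ∉ t ∧ insert j t = s :=
            ⟨s.erase j, Finset.notMem_erase j s, Finset.insert_erase hj⟩
          have e2 : diff (α + ind (insert j t)) b = diff (α + Pi.single j 1 + ind t) b := by
            rw [ind_insert hjt, add_right_comm, ← add_assoc]
          have h2 := ihs t (Finset.ssubset_insert hjt) (α + Pi.single j 1)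
          have h3 := ihs t (Finset.ssubset_insert hjt) (α + Pi.single j 1 + Pi.single j 1)
          rw [← e2] at h2
          rw [add_right_comm _ _ (ind t), diff_succ, ← e2] at h3
          have h4 := ((h1.add h2.neg).add (h3.mono hΛ
            (m' := m - ρ * ((α + Pi.single j 1).order : ℝ)) ?_).neg)
          · convert h4 using 1
            rw [diffOne_cmul_insert hjt]
            abel
          · simp only [MultiIdx.order_add, MultiIdx.order_single]
            push_cast
            linarith
        · rwa [← diffOne_cmul_of_notMem hj]
  intro s α
  simpa using key s α 0

/-- The same product rule read forwards. The induction on the outer differences `α` needs the inner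
differences `δ` and the set `s` to be arbitrary, since each step moves one difference inside. -/
theorem CoefM.coefS (hΛ : IsWeight μ Λ) (hρ : 0 < ρ) (h : CoefM Λ ρ m b)
    (s : Finset (Fin n)) : CoefS Λ ρ m (cmul s (diff (ind s) b)) := by
  have key : ∀ α : MultiIdx n, ∀ s, ∀ δ : MultiIdx n,
      CoefBdd Λ (m - ρ * (α.order : ℝ) - ρ * (δ.order : ℝ))
        (diff α (cmul s (diff (δ + ind s) b))) := by
    intro α
    induction α using MultiIdx.induction with
    | zero =>
      intro s δ
      simpa using h s δ
    | succ α j ih =>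
      intro s δ
      rw [diff_add, diff_single]
      have e1 : ∀ s, diff (δ + Pi.single j 1 + ind s) b = diffOne j (diff (δ + ind s) b) := by
        intro s
        rw [add_right_comm, diff_succ]
      have h1 := ih s (δ + Pi.single j 1)
      rw [e1] at h1
      have e : m - ρ * (α.order : ℝ) - ρ * ((δ + Pi.single j 1).order : ℝ) =
          m - ρ * ((α + Pi.single j 1).order : ℝ) - ρ * (δ.order : ℝ) := by
        simp only [MultiIdx.order_add, MultiIdx.order_single]
        push_cast
        ring
      rw [e] at h1
      by_cases hj : j ∈ s
      · obtain ⟨t, hjt, rfl⟩ : ∃ t, j ∉ t ∧ insert j t = s :=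
            ⟨s.erase j, Finset.notMem_erase j s, Finset.insert_erase hj⟩
        have e2 : diff (δ + ind (insert j t)) b = diff (δ + Pi.single j 1 + ind t) b := by
            rw [ind_insert hjt, add_right_comm, ← add_assoc]
        have h2 := ih t (δ + Pi.single j 1)
        rw [← e2, e] at h2
        have h3 := ih t (δ + Pi.single j 1 + Pi.single j 1)
        rw [add_right_comm _ _ (ind t), diff_succ, ← e2] at h3
        rw [diffOne_cmul_insert hjt, diff_fun_add, diff_fun_add]
        refine (h1.add h2).add (h3.mono hΛ ?_)
        simp only [MultiIdx.order_add, MultiIdx.order_single]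
        push_cast
        linarith
      · rwa [diffOne_cmul_of_notMem hj]
  intro α
  simpa using key α s 0

end

/-! ### The discrete Taylor (Newton) expansion and its remainder. -/

noncomputable section

/-- The multi-indices of order less than `N`. -/
def idx (n N : ℕ) : Finset (MultiIdx n) :=
  (Fintype.piFinset (fun _ : Fin n => Finset.range N)).filter (fun α : MultiIdx n => α.order < N)

@[simp] theorem mem_idx {n N : ℕ} {α : MultiIdx n} : α ∈ idx n N ↔ α.order < N := by
  simp only [idx, Finset.mem_filter, Fintype.mem_piFinset, Finset.mem_range, and_iff_right_iff_imp]
  intro h i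
  exact (Finset.single_le_sum (f := α) (fun _ _ => Nat.zero_le _) (Finset.mem_univ i)).trans_lt h

/-- The binomial coefficient `ξ^{(β)} / β!`. -/
def binom {n : ℕ} (β : MultiIdx n) (ξ : Lattice n) : ℂ := (1 / (β.fact : ℂ)) * fall β ξ

theorem fallingFactorial_pascal (l : ℕ) (x : ℂ) :
    (1 / ((l + 1).factorial : ℂ)) * ∏ r ∈ Finset.range (l + 1), (x + 1 - r) =
      (1 / ((l + 1).factorial : ℂ)) * ∏ r ∈ Finset.range (l + 1), (x - r) +
      (1 / (l.factorial : ℂ)) * ∏ r ∈ Finset.range l, (x - r) := by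
  have h : ∏ r ∈ Finset.range (l + 1), (x + 1 - r) = (∏ r ∈ Finset.range l, (x - r)) * (x + 1) := by
    rw [Finset.prod_range_succ']
    congr 1
    · refine Finset.prod_congr rfl fun r _ => ?_
      push_cast
      ring
    · simp
  rw [h, Finset.prod_range_succ, Nat.factorial_succ]
  have h1 : (l.factorial : ℂ) ≠ 0 := by exact_mod_cast l.factorial_ne_zero
  have h2 : (l : ℂ) + 1 ≠ 0 := by exact_mod_cast l.succ_ne_zero
  push_cast
  field_simp
  ring

section Binom

variable {n : ℕ}

theorem binom_eq_prod (β : MultiIdx n) (ξ : Lattice n) :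
    binom β ξ = ∏ i, (1 / ((β i).factorial : ℂ)) * ∏ r ∈ Finset.range (β i), ((ξ i : ℂ) - r) := by
  rw [Finset.prod_mul_distrib, binom, fall, MultiIdx.fact]
  push_cast
  simp

theorem binom_eq_mul_erase (β : MultiIdx n) (ξ : Lattice n) (j : Fin n) :
    binom β ξ = ((1 / ((β j).factorial : ℂ)) * ∏ r ∈ Finset.range (β j), ((ξ j : ℂ) - r)) *
      ∏ i ∈ Finset.univ.erase j,
        ((1 / ((β i).factorial : ℂ)) * ∏ r ∈ Finset.range (β i), ((ξ i : ℂ) - r)) := by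
  rw [binom_eq_prod]
  exact (Finset.mul_prod_erase Finset.univ (fun i => (1 / ((β i).factorial : ℂ)) *
    ∏ r ∈ Finset.range (β i), ((ξ i : ℂ) - r)) (Finset.mem_univ j)).symm

theorem erase_prod_congr (β β' : MultiIdx n) (ξ ξ' : Lattice n) (j : Fin n)
    (hβ : ∀ i ≠ j, β i = β' i) (hξ : ∀ i ≠ j, ξ i = ξ' i) :
    ∏ i ∈ Finset.univ.erase j,
        ((1 / ((β i).factorial : ℂ)) * ∏ r ∈ Finset.range (β i), ((ξ i : ℂ) - r)) =
    ∏ i ∈ Finset.univ.erase j,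
        ((1 / ((β' i).factorial : ℂ)) * ∏ r ∈ Finset.range (β' i), ((ξ' i : ℂ) - r)) := by
  refine Finset.prod_congr rfl fun i hi => ?_
  have := Finset.ne_of_mem_erase hi
  rw [hβ i this, hξ i this]

theorem add_single_apply_of_ne {A : Type*} [AddMonoid A] (β : Fin n → A) {i j : Fin n} (a : A)
    (h : i ≠ j) : (β + Pi.single j a : Fin n → A) i = β i := by
  rw [Pi.add_apply, Pi.single_eq_of_ne h, add_zero]

theorem binom_pascal (β : MultiIdx n) (ξ : Lattice n) (j : Fin n) :
    binom (β + Pi.single j 1) (ξ + Pi.single j 1) = binom (β + Pi.single j 1) ξ + binom β ξ := by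
  rw [binom_eq_mul_erase _ _ j, binom_eq_mul_erase _ ξ j, binom_eq_mul_erase β ξ j,
    erase_prod_congr (β + Pi.single j 1) β (ξ + Pi.single j 1) ξ j
      (fun i hi => add_single_apply_of_ne _ _ hi) (fun i hi => add_single_apply_of_ne _ _ hi),
    erase_prod_congr (β + Pi.single j 1) β ξ ξ j
      (fun i hi => add_single_apply_of_ne _ _ hi) (fun i hi => rfl), ← add_mul]
  congr 1
  simpa using fallingFactorial_pascal (β j) (ξ j)

theorem binom_add_single_of_eq_zero {β : MultiIdx n} (ξ : Lattice n) {j : Fin n} (h : β j = 0) :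
    binom β (ξ + Pi.single j 1) = binom β ξ := by
  rw [binom_eq_mul_erase _ _ j, binom_eq_mul_erase _ ξ j,
    erase_prod_congr β β (ξ + Pi.single j 1) ξ j
      (fun i hi => rfl) (fun i hi => add_single_apply_of_ne _ _ hi), h]
  simp

@[simp] theorem binom_zero (ξ : Lattice n) : binom 0 ξ = 1 := by
  simp [binom, MultiIdx.fact]

theorem binom_zero_right {β : MultiIdx n} (h : β ≠ 0) : binom β 0 = 0 := by
  obtain ⟨j, hj⟩ := Function.ne_iff.mp h
  rw [binom_eq_mul_erase _ _ j, Finset.prod_eq_zero (i := 0)]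
  · simp
  · simpa [Nat.pos_iff_ne_zero] using hj
  · simp

end Binom

/-- The remainder of order `N` in the discrete Taylor expansion of `G(k + ξ)` about `k`. -/
def taylorRem {n : ℕ} (N : ℕ) (G : Lattice n → ℂ) (k ξ : Lattice n) : ℂ :=
  G (k + ξ) - ∑ β ∈ idx n N, binom β ξ * diff β G k

section Taylor

variable {n : ℕ}

theorem taylorRem_zero_order (G : Lattice n → ℂ) (k ξ : Lattice n) :
    taylorRem 0 G k ξ = G (k + ξ) := by
  simp [taylorRem, idx]

theorem taylorRem_zero_shift (N : ℕ) (G : Lattice n → ℂ) (k : Lattice n) :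
    taylorRem (N + 1) G k 0 = 0 := by
  rw [taylorRem, Finset.sum_eq_single 0]
  · simp
  · intro β _ hβ
    rw [binom_zero_right hβ, zero_mul]
  · simp

/-- By Pascal's rule, differencing the Newton polynomial of `G` in `ξ_j` gives the Newton polynomial
of `diffOne j G`, of order one less. -/
theorem taylorRem_step (N : ℕ) (G : Lattice n → ℂ) (k ξ : Lattice n) (j : Fin n) :
    taylorRem (N + 1) G k (ξ + Pi.single j 1) =
      taylorRem (N + 1) G k ξ + taylorRem N (diffOne j G) k ξ := by
  have h : ∑ β ∈ idx n N, binom β ξ * diff β (diffOne j G) k =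
      ∑ β ∈ idx n (N + 1),
        (binom β (ξ + Pi.single j 1) * diff β G k - binom β ξ * diff β G k) := by
    refine Finset.sum_of_injOn (fun β => β + Pi.single j 1) ?_ ?_ ?_ ?_
    · exact fun a _ b _ hab => add_right_cancel hab
    · intro β hβ
      simp only [Finset.mem_coe, mem_idx, MultiIdx.order_add, MultiIdx.order_single] at hβ ⊢
      omega
    -- Indices outside the image of the shift have `β j = 0`; their binomials do not depend on
    -- `ξ_j`, so they cancel.
    · intro β hβ hβ'
      have : β j = 0 := by
        by_contra hc
        refine hβ' ⟨β - Pi.single j 1, ?_, ?_⟩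
        all_goals
          have he : β - Pi.single j 1 + Pi.single j 1 = β := by
            refine tsub_add_cancel_of_le fun i => ?_
            rcases eq_or_ne i j with rfl | hi
            · simp; omega
            · simp [hi]
        · rw [mem_idx, ← he, MultiIdx.order_add, MultiIdx.order_single] at hβ
          simpa using hβ
        · exact he
      rw [binom_add_single_of_eq_zero _ this, sub_self]
    · intro β _
      rw [binom_pascal, diff_add, diff_single]
      ring
  rw [Finset.sum_sub_distrib] at h
  rw [taylorRem, taylorRem, taylorRem, h, diffOne, ← add_assoc]
  ring

/-- The remainder vanishes at `ξ = 0`, and each unit step adds a remainder of lower order for a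
difference of `G`. A path of at most `D` steps that stays in the ball costs one factor `D` per
order. -/
theorem mul_norm_taylorRem_le {w B : ℝ} (hw : 0 ≤ w) (hB : 0 ≤ B) (D : ℕ) (k : Lattice n) (N : ℕ) :
    ∀ G : Lattice n → ℂ,
      (∀ β : MultiIdx n, β.order = N → ∀ η, l1 η ≤ D → w * ‖diff β G (k + η)‖ ≤ B) →
      ∀ ξ, l1 ξ ≤ D → w * ‖taylorRem N G k ξ‖ ≤ (D : ℝ) ^ N * B := by
  induction N with
  | zero =>
    intro G hG ξ hξ
    simpa [taylorRem_zero_order] using hG 0 (by simp) ξ hξ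
  | succ N ih =>
    intro G hG ξ hξ
    have hj : ∀ j ξ, l1 ξ ≤ D → w * ‖taylorRem N (diffOne j G) k ξ‖ ≤ (D : ℝ) ^ N * B := by
      intro j
      refine ih _ fun β hβ η hη => ?_
      rw [← diff_single, ← diff_add]
      exact hG _ (by rw [MultiIdx.order_add, hβ, MultiIdx.order_single]) η hη
    have key : ∀ ξ, l1 ξ ≤ D → w * ‖taylorRem (N + 1) G k ξ‖ ≤ l1 ξ * ((D : ℝ) ^ N * B) := by
      intro ξ
      induction ξ using lattice_induction with
      | zero => simp [taylorRem_zero_shift]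
      | up ξ j hl ihξ =>
        intro h
        rw [hl] at h ⊢
        rw [taylorRem_step]
        have h1 := ihξ (by omega)
        have h2 := hj j ξ (by omega)
        have h3 := mul_le_mul_of_nonneg_left
          (norm_add_le (taylorRem (N + 1) G k ξ) (taylorRem N (diffOne j G) k ξ)) hw
        push_cast
        linarith
      | down ξ j hl ihξ =>
        intro h
        have h1 := ihξ (by omega)
        have h2 := hj j ξ h
        rw [taylorRem_step] at h1
        have h3 := mul_le_mul_of_nonneg_left (norm_sub_le
          (taylorRem (N + 1) G k ξ + taylorRem N (diffOne j G) k ξ)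
          (taylorRem N (diffOne j G) k ξ)) hw
        rw [add_sub_cancel_right] at h3
        rw [hl]
        push_cast
        linarith
    refine (key ξ hξ).trans ?_
    rw [pow_succ', mul_assoc]
    have h : (l1 ξ : ℝ) ≤ D := by exact_mod_cast hξ
    exact mul_le_mul_of_nonneg_right h (by positivity)

theorem diff_taylorRem (N : ℕ) (α : MultiIdx n) (G : Lattice n → ℂ) (k ξ : Lattice n) :
    diff α (fun l => taylorRem N G l ξ) k = taylorRem N (diff α G) k ξ := by
  unfold taylorRem
  rw [diff_sub, diff_shift, diff_sum]
  simp only [diff_const_mul, ← diff_add, add_comm α]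

end Taylor

end

/-! ### The Taylor remainder in the class `M`. -/

noncomputable section

theorem jb_le_one_add_l1 {n : ℕ} (η : Lattice n) : jb η ≤ 1 + l1 η := by
  refine (jb_le_one_add_sum η).trans (le_of_eq ?_)
  unfold l1
  push_cast
  congr 1
  exact Finset.sum_congr rfl fun i _ => by rw [Nat.cast_natAbs, Int.cast_abs]

section CoefTaylor

variable {n : ℕ} {Λ : Lattice n → ℝ} {ρ m μ : ℝ} {b : Coef n}

/-- Each `|k_i|` is at most `jb η * (1 + |(k + η)_i|)`, and expanding the product of these factors
gives the sum over subsets. -/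
theorem norm_monomial_ind_le (s : Finset (Fin n)) (k η : Lattice n) :
    ‖(monomial (ind s) k : ℂ)‖ ≤
      jb η ^ n * ∑ t ∈ s.powerset, ‖(monomial (ind t) (k + η) : ℂ)‖ := by
  have hm : ∀ (t : Finset (Fin n)) (l : Lattice n),
      ‖(monomial (ind t) l : ℂ)‖ = ∏ i ∈ t, |(l i : ℝ)| := by
    intro t l
    rw [monomial_ind]
    push_cast
    rw [norm_prod]
    simp
  simp only [hm]
  rw [← Finset.prod_one_add]
  have h1 : ∀ i, |(k i : ℝ)| ≤ jb η * (1 + |((k + η) i : ℝ)|) := by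
    intro i
    have h2 := abs_le_jb η i
    have h3 := one_le_jb η
    have h4 : |(k i : ℝ)| ≤ |((k + η) i : ℝ)| + |(η i : ℝ)| := by
      rw [← abs_neg (η i : ℝ)]
      refine le_trans (le_of_eq ?_) (abs_add_le _ _)
      congr 1
      simp
    have h5 := abs_nonneg ((k + η) i : ℝ)
    nlinarith
  calc ∏ i ∈ s, |(k i : ℝ)| ≤ ∏ i ∈ s, (jb η * (1 + |((k + η) i : ℝ)|)) :=
        Finset.prod_le_prod (fun _ _ => abs_nonneg _) fun i _ => h1 i
    _ = jb η ^ s.card * ∏ i ∈ s, (1 + |((k + η) i : ℝ)|) := by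
        rw [Finset.prod_mul_distrib, Finset.prod_const]
    _ ≤ _ := by
        gcongr
        · exact one_le_jb η
        · simpa using s.card_le_univ

/-- After moving the monomial to `k + η`, a subset `t` of `s` leaves the differences in `s \ t`
unmatched, which only improves the order; temperateness returns the weight to `k`. Taking `K` and
`M` as data lets one exponent serve all `β` of a given order. -/
theorem CoefM.exists_shift_le (hΛ : IsWeight μ Λ) (hρ : 0 < ρ) (h : CoefM Λ ρ m b)
    (s : Finset (Fin n)) (α : MultiIdx n) {K : ℝ} {M : ℕ}
    (hP : ∀ k η, Λ (k + η) ^ (m - ρ * (α.order : ℝ)) ≤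
      K * Λ k ^ (m - ρ * (α.order : ℝ)) * jb η ^ M) (N : ℕ) :
    ∃ C : ℝ, 0 ≤ C ∧ ∀ k η ξ,
      jb ξ ^ N * ‖(monomial (ind s) k : ℂ) * diff (α + ind s) b (k + η) ξ‖ ≤
        C * Λ k ^ (m - ρ * (α.order : ℝ)) * jb η ^ (n + M) := by
  have h1 : ∀ t : Finset (Fin n), ∃ C : ℝ, t ⊆ s → ∀ k ξ,
      jb ξ ^ N * ‖(monomial (ind t) k : ℂ) * diff (α + ind s) b k ξ‖ ≤
        C * Λ k ^ (m - ρ * (α.order : ℝ)) := by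
    intro t
    by_cases hts : t ⊆ s
    · have h2 := h t (α + ind (s \ t))
      rw [add_assoc, ind_sdiff_add hts] at h2
      obtain ⟨C, hC⟩ := h2.mono hΛ (m' := m - ρ * (α.order : ℝ)) (by
        rw [MultiIdx.order_add]
        push_cast
        have : 0 ≤ ρ * ((ind (s \ t)).order : ℝ) := by positivity
        linarith) N
      exact ⟨C, fun _ => hC⟩
    · exact ⟨0, fun h => absurd h hts⟩
  choose C hC using h1
  set e := m - ρ * (α.order : ℝ)
  have hK : 0 ≤ K := by
    have h2 := hP 0 0
    have h3 : 0 < Λ 0 ^ e := Real.rpow_pos_of_pos (hΛ.pos 0) _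
    have h4 : jb (0 : Lattice n) = 1 := by simp [jb, latticeNorm]
    rw [add_zero, h4, one_pow, mul_one] at h2
    by_contra hc
    nlinarith
  refine ⟨(∑ t ∈ s.powerset, |C t|) * K, by positivity, fun k η ξ => ?_⟩
  have hη := jb_pos η
  have hξ := jb_pos ξ
  have hk := hΛ.pos k
  have hkη := hΛ.pos (k + η)
  calc jb ξ ^ N * ‖(monomial (ind s) k : ℂ) * diff (α + ind s) b (k + η) ξ‖
      = jb ξ ^ N * (‖(monomial (ind s) k : ℂ)‖ * ‖diff (α + ind s) b (k + η) ξ‖) := by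
        rw [norm_mul]
    _ ≤ jb ξ ^ N * ((jb η ^ n * ∑ t ∈ s.powerset, ‖(monomial (ind t) (k + η) : ℂ)‖) *
          ‖diff (α + ind s) b (k + η) ξ‖) := by
        gcongr
        exact norm_monomial_ind_le s k η
    _ = jb η ^ n * ∑ t ∈ s.powerset, jb ξ ^ N *
          ‖(monomial (ind t) (k + η) : ℂ) * diff (α + ind s) b (k + η) ξ‖ := by
        simp only [norm_mul, Finset.mul_sum, Finset.sum_mul]
        exact Finset.sum_congr rfl fun t _ => by ring
    _ ≤ jb η ^ n * ∑ t ∈ s.powerset, |C t| * Λ (k + η) ^ e := by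
        refine mul_le_mul_of_nonneg_left (Finset.sum_le_sum fun t ht => ?_) (by positivity)
        refine (hC t (Finset.mem_powerset.mp ht) (k + η) ξ).trans ?_
        gcongr
        exact le_abs_self _
    _ ≤ jb η ^ n * ∑ t ∈ s.powerset, |C t| * (K * Λ k ^ e * jb η ^ M) := by
        gcongr
        exact hP k η
    _ = _ := by
        rw [← Finset.sum_mul, pow_add]
        ring

/-- The remainder of order `N` in the Taylor expansion of `b(k + ξ, ξ)`. -/
def taylorCoef (N : ℕ) (b : Coef n) : Coef n :=
  fun k ξ => taylorRem N (fun l => b l ξ) k ξ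

theorem diff_taylorCoef (N : ℕ) (α : MultiIdx n) (b : Coef n) :
    diff α (taylorCoef N b) = taylorCoef N (diff α b) := by
  funext k ξ
  rw [diff_apply]
  unfold taylorCoef
  rw [diff_taylorRem]
  congr 1
  funext l
  rw [diff_apply]

/-- Replacing `b(k, ξ)` by `b(k + ξ, ξ)` and subtracting the Taylor polynomial lowers the order. -/
theorem CoefM.taylorCoef (hΛ : IsWeight μ Λ) (hρ : 0 < ρ) (h : CoefM Λ ρ m b) (N : ℕ) :
    CoefM Λ ρ (m - ρ * (N : ℝ)) (taylorCoef N b) := by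
  intro s α P
  obtain ⟨K, M, hK, hP⟩ := hΛ.exists_rpow_shift_le (m - ρ * (N : ℝ) - ρ * (α.order : ℝ))
  -- Of the decay `P + (n + M) + N` demanded in `ξ`, the part `n + M` pays for the shift, `N` pays
  -- for the path length in the remainder bound, and `P` is left over.
  have h1 : ∀ β : MultiIdx n, ∃ C : ℝ, 0 ≤ C ∧ (β.order = N → ∀ k η ξ,
      jb ξ ^ (P + (n + M) + N) *
        ‖(monomial (ind s) k : ℂ) * diff (β + (α + ind s)) b (k + η) ξ‖ ≤
        C * Λ k ^ (m - ρ * (N : ℝ) - ρ * (α.order : ℝ)) * jb η ^ (n + M)) := by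
    intro β
    by_cases hβ : β.order = N
    · have e : m - ρ * ((β + α).order : ℝ) = m - ρ * (N : ℝ) - ρ * (α.order : ℝ) := by
        rw [MultiIdx.order_add, hβ]
        push_cast
        ring
      obtain ⟨C, hC0, hC⟩ := h.exists_shift_le hΛ hρ s (β + α) (K := K) (M := M)
        (by rw [e]; exact hP) (P + (n + M) + N)
      rw [e, add_assoc β] at hC
      exact ⟨C, hC0, fun _ => hC⟩
    · exact ⟨0, le_rfl, fun h => absurd h hβ⟩
  choose C hC0 hC using h1
  set e := m - ρ * (N : ℝ) - ρ * (α.order : ℝ)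
  set A := ∑ β ∈ idx n (N + 1), C β
  have hA0 : 0 ≤ A := Finset.sum_nonneg fun β _ => hC0 β
  refine ⟨(n : ℝ) ^ N * (A * (1 + n) ^ (n + M)), fun k ξ => ?_⟩
  have hξ := jb_pos ξ
  have hk := hΛ.pos k
  have hl := l1_le_mul_jb ξ
  -- With `D = l1 ξ`, every intermediate point satisfies `jb η ≤ (1 + n) * jb ξ`.
  have key := mul_norm_taylorRem_le (n := n)
    (w := jb ξ ^ (P + (n + M) + N) * ‖(monomial (ind s) k : ℂ)‖)
    (B := A * Λ k ^ e * ((1 + n) * jb ξ) ^ (n + M)) (by positivity) (by positivity)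
    (l1 ξ) k N (fun l => diff (α + ind s) b l ξ) (fun β hβ η hη => by
      rw [← diff_apply, ← diff_add, mul_assoc, ← norm_mul]
      refine (hC β hβ k η ξ).trans ?_
      have h2 : C β ≤ A := Finset.single_le_sum (f := C) (fun β _ => hC0 β) (by simp [hβ])
      have h3 : jb η ≤ (1 + n) * jb ξ := by
        have h4 := jb_le_one_add_l1 η
        have h5 : (l1 η : ℝ) ≤ l1 ξ := by exact_mod_cast hη
        have h6 := one_le_jb ξ
        nlinarith
      have := jb_pos η
      gcongr) ξ le_rfl
  have h7 : jb ξ ^ (n + M + N) *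
      (jb ξ ^ P * ‖cmul s (diff (α + ind s) (LatticePDO.taylorCoef N b)) k ξ‖) ≤
      jb ξ ^ (n + M + N) * ((n : ℝ) ^ N * (A * (1 + n) ^ (n + M)) * Λ k ^ e) := by
    rw [diff_taylorCoef]
    simp only [cmul, norm_mul, LatticePDO.taylorCoef]
    calc _ = jb ξ ^ (P + (n + M) + N) * ‖(monomial (ind s) k : ℂ)‖ *
          ‖taylorRem N (fun l => diff (α + ind s) b l ξ) k ξ‖ := by ring
      _ ≤ (l1 ξ : ℝ) ^ N * (A * Λ k ^ e * ((1 + n) * jb ξ) ^ (n + M)) := key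
      _ ≤ (n * jb ξ) ^ N * (A * Λ k ^ e * ((1 + n) * jb ξ) ^ (n + M)) := by gcongr
      _ = _ := by
        rw [mul_pow, mul_pow]
        ring
  exact le_of_mul_le_mul_left h7 (by positivity)

end CoefTaylor

end

/-! ### Fourier coefficients of smooth functions on the torus. -/

noncomputable section

instance {n : ℕ} : IsProbabilityMeasure (torusMeasure n) := by
  unfold torusMeasure; infer_instance

instance {n : ℕ} : (torusMeasure n).IsAddHaarMeasure := by
  unfold torusMeasure; infer_instance

instance {n : ℕ} : (torusMeasure n).IsNegInvariant :=
  Measure.IsAddHaarMeasure.isNegInvariant_of_regular _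

/-- The Fourier coefficient `∫ e^{-2πi ξ·x} u(x) dx`. -/
def coef {n : ℕ} (u : Torus n → ℂ) (ξ : Lattice n) : ℂ :=
  ∫ x, UnitAddTorus.mFourier (-ξ) x * u x ∂(torusMeasure n)

/-- The sum of the Fourier series with coefficients `c`. -/
def fourierSum {n : ℕ} (c : Lattice n → ℂ) (x : Torus n) : ℂ :=
  ∑' ξ, c ξ * UnitAddTorus.mFourier ξ x

section Fourier

variable {n : ℕ}

theorem coef_eq_mFourierCoeff (u : Torus n → ℂ) (ξ : Lattice n) :
    coef u ξ = UnitAddTorus.mFourierCoeff u ξ := rfl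

theorem norm_mFourier_apply (ξ : Lattice n) (x : Torus n) : ‖UnitAddTorus.mFourier ξ x‖ = 1 := by
  simp [UnitAddTorus.mFourier, norm_prod, Circle.norm_coe]

theorem mFourier_add_apply (ξ : Lattice n) (x y : Torus n) :
    UnitAddTorus.mFourier ξ (x + y) = UnitAddTorus.mFourier ξ x * UnitAddTorus.mFourier ξ y := by
  simp [UnitAddTorus.mFourier, Finset.prod_mul_distrib, AddCircle.toCircle_add]

theorem mFourier_neg_apply (ξ : Lattice n) (x : Torus n) :
    UnitAddTorus.mFourier ξ (-x) = UnitAddTorus.mFourier (-ξ) x := by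
  simp [UnitAddTorus.mFourier]

theorem mFourier_neg_mul_self (ξ : Lattice n) (x : Torus n) :
    UnitAddTorus.mFourier (-ξ) x * UnitAddTorus.mFourier ξ x = 1 := by
  rw [← UnitAddTorus.mFourier_add, neg_add_cancel, UnitAddTorus.mFourier_zero]
  rfl

theorem mFourier_single_apply (ξ : Lattice n) (j : Fin n) (a : UnitAddCircle) :
    UnitAddTorus.mFourier ξ (Pi.single j a) = fourier (ξ j) a := by
  change ∏ i, fourier (ξ i) ((Pi.single j a : Torus n) i) = _
  rw [Finset.prod_eq_single j]
  · rw [Pi.single_eq_same]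
  · intro i _ hi
    rw [Pi.single_eq_of_ne hi, fourier_eval_zero]
  · simp

theorem coef_mFourier (η ξ : Lattice n) :
    coef (UnitAddTorus.mFourier η) ξ = if ξ = η then 1 else 0 := by
  classical
  rw [coef_eq_mFourierCoeff, ← UnitAddTorus.mFourierCoeff_toLp, ← UnitAddTorus.mFourierBasis_repr]
  change UnitAddTorus.mFourierBasis.repr (UnitAddTorus.mFourierLp 2 η) ξ = _
  rw [← UnitAddTorus.coe_mFourierBasis, HilbertBasis.repr_self, lp.coeFn_single]
  simp [Pi.single_apply]

theorem norm_coef_le {u : Torus n → ℂ} {C : ℝ} (h : ∀ x, ‖u x‖ ≤ C) (ξ : Lattice n) :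
    ‖coef u ξ‖ ≤ C := by
  have := norm_integral_le_of_norm_le_const (μ := torusMeasure n)
    (f := fun x => UnitAddTorus.mFourier (-ξ) x * u x) (C := C)
    (Filter.Eventually.of_forall fun x => by simpa [norm_mFourier_apply] using h x)
  simpa [coef] using this

theorem integrable_of_continuous {u : Torus n → ℂ} (h : Continuous u) :
    Integrable u (torusMeasure n) :=
  h.integrable_of_hasCompactSupport (HasCompactSupport.of_compactSpace u)

theorem integrable_mFourier_mul {u : Torus n → ℂ} (h : Continuous u) (ξ : Lattice n) :
    Integrable (fun x => UnitAddTorus.mFourier ξ x * u x) (torusMeasure n) :=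
  integrable_of_continuous ((UnitAddTorus.mFourier ξ).continuous.mul h)

theorem coef_sub {u v : Torus n → ℂ} (hu : Continuous u) (hv : Continuous v) (ξ : Lattice n) :
    coef (u - v) ξ = coef u ξ - coef v ξ := by
  simp only [coef, Pi.sub_apply, mul_sub]
  exact integral_sub (integrable_mFourier_mul hu _) (integrable_mFourier_mul hv _)

theorem coef_const_mul (a : ℂ) (u : Torus n → ℂ) (ξ : Lattice n) :
    coef (fun x => a * u x) ξ = a * coef u ξ := by
  simp only [coef, mul_left_comm _ a]
  exact integral_const_mul a _

theorem coef_sum {ι : Type*} (s : Finset ι) {u : ι → Torus n → ℂ} (hu : ∀ i, Continuous (u i))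
    (ξ : Lattice n) : coef (fun x => ∑ i ∈ s, u i x) ξ = ∑ i ∈ s, coef (u i) ξ := by
  simp only [coef, Finset.mul_sum]
  exact integral_finsetSum _ fun i _ => integrable_mFourier_mul (hu i) _

theorem isOpenQuotientMap_coe_torus :
    IsOpenQuotientMap (fun (y : Fin n → ℝ) (i : Fin n) => (y i : UnitAddCircle)) :=
  IsOpenQuotientMap.piMap fun _ => QuotientAddGroup.isOpenQuotientMap_mk

theorem exists_coe_torus_eq (x : Torus n) :
    ∃ y : Fin n → ℝ, (fun i => (y i : UnitAddCircle)) = x :=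
  isOpenQuotientMap_coe_torus.surjective x

theorem coe_torus_add_smul (y : Fin n → ℝ) (j : Fin n) (t : ℝ) :
    (fun i => ((y + t • Pi.single j (1 : ℝ) : Fin n → ℝ) i : UnitAddCircle)) =
      (fun i => (y i : UnitAddCircle)) + Pi.single j (t : UnitAddCircle) := by
  funext i
  rcases eq_or_ne i j with rfl | h
  · simp
  · simp [h]

theorem TorusSmooth.continuous {u : Torus n → ℂ} (h : TorusSmooth u) : Continuous u :=
  isOpenQuotientMap_coe_torus.isQuotientMap.continuous_iff.mpr (ContDiff.continuous h)

theorem TorusSmooth.exists_norm_le {u : Torus n → ℂ} (h : TorusSmooth u) :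
    ∃ C : ℝ, ∀ x, ‖u x‖ ≤ C := by
  obtain ⟨C, hC⟩ := (isCompact_range h.continuous.norm).bddAbove
  exact ⟨C, fun x => hC ⟨x, rfl⟩⟩

theorem TorusSmooth.sub {u v : Torus n → ℂ} (hu : TorusSmooth u) (hv : TorusSmooth v) :
    TorusSmooth (u - v) :=
  ContDiff.sub hu hv

theorem TorusSmooth.const_mul {u : Torus n → ℂ} (hu : TorusSmooth u) (a : ℂ) :
    TorusSmooth (fun x => a * u x) :=
  contDiff_const.mul hu

theorem TorusSmooth.conj {u : Torus n → ℂ} (hu : TorusSmooth u) :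
    TorusSmooth (fun x => conj (u x)) :=
  (Complex.conjCLE.contDiff (n := ∞)).comp hu

theorem TorusSmooth.sum {ι : Type*} (s : Finset ι) {u : ι → Torus n → ℂ}
    (hu : ∀ i, TorusSmooth (u i)) : TorusSmooth (fun x => ∑ i ∈ s, u i x) :=
  ContDiff.sum fun i _ => hu i

theorem TorusSmooth.hasDerivAt_zero {u : Torus n → ℂ} (hu : TorusSmooth u) (j : Fin n)
    (y : Fin n → ℝ) :
    HasDerivAt (fun t : ℝ => u ((fun i => (y i : UnitAddCircle)) + Pi.single j (t : UnitAddCircle)))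
      (fderiv ℝ (fun y : Fin n → ℝ => u (fun i => (y i : UnitAddCircle))) y (Pi.single j 1)) 0 := by
  have h1 : DifferentiableAt ℝ (fun y : Fin n → ℝ => u (fun i => (y i : UnitAddCircle)))
      (y + (0 : ℝ) • Pi.single j (1 : ℝ)) :=
    (ContDiff.differentiable hu (by simp)).differentiableAt
  have h2 : HasDerivAt (fun t : ℝ => y + t • (Pi.single j (1 : ℝ) : Fin n → ℝ))
      (Pi.single j 1) 0 := by
    simpa using ((hasDerivAt_id (0 : ℝ)).smul_const (Pi.single j (1 : ℝ) : Fin n → ℝ)).const_add y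
  have h3 := h1.hasFDerivAt.comp_hasDerivAt (0 : ℝ) h2
  rw [zero_smul, add_zero] at h3
  simpa only [Function.comp_def, coe_torus_add_smul] using h3

theorem TorusSmooth.dOne_coe {u : Torus n → ℂ} (hu : TorusSmooth u) (j : Fin n)
    (y : Fin n → ℝ) :
    dOne j u (fun i => (y i : UnitAddCircle)) = (2 * Real.pi * Complex.I)⁻¹ *
      fderiv ℝ (fun y : Fin n → ℝ => u (fun i => (y i : UnitAddCircle))) y (Pi.single j 1) := by
  rw [dOne, (hu.hasDerivAt_zero j y).deriv]

theorem TorusSmooth.hasDerivAt {u : Torus n → ℂ} (hu : TorusSmooth u) (j : Fin n)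
    (x : Torus n) (t : ℝ) :
    HasDerivAt (fun s : ℝ => u (x + Pi.single j (s : UnitAddCircle)))
      (2 * Real.pi * Complex.I * dOne j u (x + Pi.single j (t : UnitAddCircle))) t := by
  obtain ⟨y, hy⟩ := exists_coe_torus_eq (x + Pi.single j (t : UnitAddCircle))
  have h1 := hu.hasDerivAt_zero j y
  have h2 := hu.dOne_coe j y
  rw [hy] at h1 h2
  rw [h2, mul_inv_cancel_left₀ Complex.two_pi_I_ne_zero]
  rw [← sub_self t] at h1
  have h3 := HasDerivAt.comp_sub_const t t h1
  have h4 : (fun s : ℝ => u (x + Pi.single j (s : UnitAddCircle))) = fun s : ℝ =>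
      u (x + Pi.single j (t : UnitAddCircle) + Pi.single j ((s - t : ℝ) : UnitAddCircle)) := by
    funext s
    rw [add_assoc, ← Pi.single_add]
    congr 3
    simp
  rw [h4]
  exact h3

theorem TorusSmooth.dOne {u : Torus n → ℂ} (hu : TorusSmooth u) (j : Fin n) :
    TorusSmooth (dOne j u) := by
  unfold TorusSmooth
  simp only [hu.dOne_coe j]
  refine contDiff_const.mul (ContDiff.clm_apply ?_ contDiff_const)
  exact ContDiff.fderiv_right (m := ∞) hu (by simp)

/-- Invariance of Haar measure. Differentiating this identity in the translation at `0` takes the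
place of integration by parts in `TorusSmooth.coef_dOne`. -/
theorem integral_mFourier_neg_mul_translate (u : Torus n → ℂ) (ξ : Lattice n) (j : Fin n)
    (a : UnitAddCircle) :
    ∫ x, UnitAddTorus.mFourier (-ξ) x * u (x + Pi.single j a) ∂(torusMeasure n) =
      fourier (ξ j) a * coef u ξ := by
  rw [coef, ← integral_add_right_eq_self (μ := torusMeasure n)
    (fun x => UnitAddTorus.mFourier (-ξ) x * u x) (Pi.single j a), ← integral_const_mul]
  congr 1
  funext x
  rw [mFourier_add_apply, ← mFourier_single_apply ξ j]
  have := mFourier_neg_mul_self ξ (Pi.single j a)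
  linear_combination (-UnitAddTorus.mFourier (-ξ) x * u (x + Pi.single j a)) * this

theorem TorusSmooth.hasDerivAt_integral_translate {u : Torus n → ℂ} (hu : TorusSmooth u)
    (j : Fin n) (ξ : Lattice n) :
    HasDerivAt (fun t : ℝ => ∫ x, UnitAddTorus.mFourier (-ξ) x *
        u (x + Pi.single j (t : UnitAddCircle)) ∂(torusMeasure n))
      (∫ x, UnitAddTorus.mFourier (-ξ) x * (2 * Real.pi * Complex.I *
        LatticePDO.dOne j u (x + Pi.single j ((0 : ℝ) : UnitAddCircle))) ∂(torusMeasure n)) 0 := by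
  obtain ⟨C, hC⟩ := (hu.dOne j).exists_norm_le
  let F : ℝ → Torus n → ℂ := fun t x => UnitAddTorus.mFourier (-ξ) x *
    u (x + Pi.single j (t : UnitAddCircle))
  let F' : ℝ → Torus n → ℂ := fun t x => UnitAddTorus.mFourier (-ξ) x *
    (2 * Real.pi * Complex.I * LatticePDO.dOne j u (x + Pi.single j (t : UnitAddCircle)))
  have hF : ∀ t : ℝ, Integrable (F t) (torusMeasure n) :=
    fun t => integrable_mFourier_mul (hu.continuous.comp (continuous_add_const _)) _
  have hF' : Integrable (F' 0) (torusMeasure n) :=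
    integrable_mFourier_mul (continuous_const.mul
      ((hu.dOne j).continuous.comp (continuous_add_const _))) _
  have hb : ∀ᵐ x ∂(torusMeasure n), ∀ t ∈ (Set.univ : Set ℝ),
      ‖F' t x‖ ≤ ‖(2 * Real.pi * Complex.I : ℂ)‖ * C := by
    refine Filter.Eventually.of_forall fun x t _ => ?_
    rw [norm_mul, norm_mFourier_apply, one_mul, norm_mul]
    exact mul_le_mul_of_nonneg_left (hC _) (norm_nonneg _)
  have hd : ∀ᵐ x ∂(torusMeasure n), ∀ t ∈ (Set.univ : Set ℝ),
      HasDerivAt (fun s => F s x) (F' t x) t :=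
    Filter.Eventually.of_forall fun x t _ => (hu.hasDerivAt j x t).const_mul _
  have hm : ∀ᶠ t in nhds (0 : ℝ), AEStronglyMeasurable (F t) (torusMeasure n) :=
    Filter.Eventually.of_forall fun t => (hF t).aestronglyMeasurable
  have key := fun h1 h2 h3 h4 h5 h6 h7 => hasDerivAt_integral_of_dominated_loc_of_deriv_le
    (μ := torusMeasure n) (s := Set.univ) (F := F) (x₀ := (0 : ℝ)) (F' := F')
    (bound := fun _ => ‖(2 * Real.pi * Complex.I : ℂ)‖ * C) h1 h2 h3 h4 h5 h6 h7
  exact (key Filter.univ_mem hm (hF 0) hF'.aestronglyMeasurable hb (integrable_const _) hd).2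

theorem TorusSmooth.coef_dOne {u : Torus n → ℂ} (hu : TorusSmooth u) (j : Fin n) (ξ : Lattice n) :
    coef (LatticePDO.dOne j u) ξ = ξ j * coef u ξ := by
  have h1 := hu.hasDerivAt_integral_translate j ξ
  simp only [integral_mFourier_neg_mul_translate] at h1
  have h4 := h1.unique ((hasDerivAt_fourier (1 : ℝ) (ξ j) 0).mul_const (coef u ξ))
  rw [QuotientAddGroup.mk_zero, fourier_eval_zero, Pi.single_zero] at h4
  simp only [add_zero] at h4
  have h5 := coef_const_mul (2 * Real.pi * Complex.I) (LatticePDO.dOne j u) ξ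
  rw [coef, h4] at h5
  refine mul_left_cancel₀ Complex.two_pi_I_ne_zero (h5.symm.trans ?_)
  simp
  ring

theorem TorusSmooth.dFallOne_aux {u : Torus n → ℂ} (hu : TorusSmooth u) (j : Fin n) (l : ℕ) :
    TorusSmooth (dFallOne j l u) ∧
      ∀ ξ, coef (dFallOne j l u) ξ = (∏ r ∈ Finset.range l, ((ξ j : ℂ) - r)) * coef u ξ := by
  induction l with
  | zero => exact ⟨hu, fun ξ => by simp [dFallOne]⟩
  | succ l ih =>
    have e : dFallOne j (l + 1) u =
      LatticePDO.dOne j (dFallOne j l u) - fun x => (l : ℂ) * dFallOne j l u x := rfl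
    rw [e]
    have h1 := ih.1.dOne j
    have h2 := ih.1.const_mul (l : ℂ)
    refine ⟨h1.sub h2, fun ξ => ?_⟩
    rw [coef_sub h1.continuous h2.continuous, coef_const_mul, ih.1.coef_dOne, ih.2,
      Finset.prod_range_succ]
    ring

theorem TorusSmooth.dFall_aux {u : Torus n → ℂ} (hu : TorusSmooth u) (β : MultiIdx n) :
    TorusSmooth (dFall β u) ∧ ∀ ξ, coef (dFall β u) ξ = fall β ξ * coef u ξ := by
  have key : ∀ l : List (Fin n),
      TorusSmooth (l.foldr (fun j v => dFallOne j (β j) v) u) ∧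
      ∀ ξ, coef (l.foldr (fun j v => dFallOne j (β j) v) u) ξ =
        (l.map fun j => ∏ r ∈ Finset.range (β j), ((ξ j : ℂ) - r)).prod * coef u ξ := by
    intro l
    induction l with
    | nil => exact ⟨hu, fun ξ => by simp⟩
    | cons j l ih =>
      obtain ⟨h1, h2⟩ := ih.1.dFallOne_aux j (β j)
      refine ⟨h1, fun ξ => ?_⟩
      rw [List.foldr_cons, h2, ih.2, List.map_cons, List.prod_cons, mul_assoc]
  obtain ⟨h1, h2⟩ := key (List.finRange n)
  refine ⟨h1, fun ξ => ?_⟩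
  rw [fall, Fin.prod_univ_def]
  exact h2 ξ

theorem TorusSmooth.dFall {u : Torus n → ℂ} (hu : TorusSmooth u) (β : MultiIdx n) :
    TorusSmooth (dFall β u) := (hu.dFall_aux β).1

theorem TorusSmooth.coef_dFall {u : Torus n → ℂ} (hu : TorusSmooth u) (β : MultiIdx n)
    (ξ : Lattice n) : coef (LatticePDO.dFall β u) ξ = fall β ξ * coef u ξ := (hu.dFall_aux β).2 ξ

theorem TorusSmooth.rapidDecay_coef {u : Torus n → ℂ} (hu : TorusSmooth u) :
    RapidDecay (coef u) := by
  refine rapidDecay_iff.mpr fun N => ?_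
  obtain ⟨C, hC⟩ := exists_jb_pow_mul_le (ι := Unit) (b := fun _ => coef u) (w := fun _ => 1)
    (fun β => by
      obtain ⟨C, hC⟩ := (hu.dFall β).exists_norm_le
      refine ⟨C, fun _ ξ => ?_⟩
      rw [← hu.coef_dFall, mul_one]
      exact norm_coef_le hC ξ) N 0
  exact ⟨C, fun ξ => by simpa using hC () ξ⟩

theorem TorusSmooth.hasSum {u : Torus n → ℂ} (hu : TorusSmooth u) (x : Torus n) :
    HasSum (fun ξ => coef u ξ * UnitAddTorus.mFourier ξ x) (u x) :=
  UnitAddTorus.hasSum_mFourier_series_apply_of_summable (f := ⟨u, hu.continuous⟩)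
    hu.rapidDecay_coef.summable_norm.of_norm x

theorem TorusSmooth.norm_le_tsum {u : Torus n → ℂ} (hu : TorusSmooth u) (x : Torus n) :
    ‖u x‖ ≤ ∑' ξ, ‖coef u ξ‖ := by
  rw [← (hu.hasSum x).tsum_eq]
  have h : ∀ ξ, ‖coef u ξ * UnitAddTorus.mFourier ξ x‖ = ‖coef u ξ‖ := fun ξ => by
    rw [norm_mul, norm_mFourier_apply, mul_one]
  refine (norm_tsum_le_tsum_norm ?_).trans (le_of_eq ?_)
  · simpa only [h] using hu.rapidDecay_coef.summable_norm
  · simp only [h]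

end Fourier

end

/-! ### Fourier series with rapidly decreasing coefficients. -/

noncomputable section

theorem iteratedDeriv_cexp_mul_I (k : ℕ) :
    iteratedDeriv k (fun t : ℝ => Complex.exp (t * Complex.I)) =
      fun t : ℝ => Complex.I ^ k * Complex.exp (t * Complex.I) := by
  induction k with
  | zero => simp
  | succ k ih =>
    rw [iteratedDeriv_succ, ih]
    funext t
    have h : HasDerivAt (fun t : ℝ => Complex.exp (t * Complex.I))
        (Complex.exp (t * Complex.I) * (1 * Complex.I)) t :=
      ((Complex.ofRealCLM.hasDerivAt (x := t)).mul_const Complex.I).cexp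
    rw [(h.const_mul (Complex.I ^ k)).deriv]
    ring

section FourierSum

variable {n : ℕ}

/-- The linear phase `y ↦ 2π ξ·y`. -/
def phase (ξ : Lattice n) : (Fin n → ℝ) →L[ℝ] ℝ :=
  ∑ i, (2 * Real.pi * ξ i) • ContinuousLinearMap.proj (R := ℝ) (φ := fun _ : Fin n => ℝ) i

theorem mFourier_coe (ξ : Lattice n) (y : Fin n → ℝ) :
    UnitAddTorus.mFourier ξ (fun i => (y i : UnitAddCircle)) =
      Complex.exp (phase ξ y * Complex.I) := by
  change ∏ i, fourier (ξ i) (y i : UnitAddCircle) = _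
  simp only [fourier_coe_apply]
  rw [← Complex.exp_sum]
  congr 1
  simp only [phase, _root_.sum_apply, _root_.smul_apply,
    ContinuousLinearMap.proj_apply, smul_eq_mul]
  push_cast
  rw [Finset.sum_mul]
  exact Finset.sum_congr rfl fun i _ => by ring

theorem norm_phase_le (ξ : Lattice n) : ‖phase ξ‖ ≤ 2 * Real.pi * n * jb ξ := by
  calc ‖phase ξ‖ ≤ ∑ _i : Fin n, 2 * Real.pi * jb ξ := by
        refine norm_sum_le_of_le _ fun i _ => ?_
        rw [norm_smul]
        have h1 : ‖(2 * Real.pi * ξ i : ℝ)‖ ≤ 2 * Real.pi * jb ξ := by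
          rw [norm_mul, Real.norm_of_nonneg Real.two_pi_pos.le, Real.norm_eq_abs]
          have := Real.pi_pos
          gcongr
          exact abs_le_jb ξ i
        have h2 : ‖ContinuousLinearMap.proj (R := ℝ) (φ := fun _ : Fin n => ℝ) i‖ ≤ 1 := by
          refine ContinuousLinearMap.opNorm_le_bound _ zero_le_one fun y => ?_
          rw [one_mul]
          exact norm_le_pi_norm y i
        calc _ ≤ 2 * Real.pi * jb ξ * 1 :=
              mul_le_mul h1 h2 (norm_nonneg _) ((norm_nonneg _).trans h1)
          _ = _ := mul_one _
    _ = _ := by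
        rw [Finset.sum_const, Finset.card_univ, Fintype.card_fin, nsmul_eq_mul]
        ring

theorem contDiff_cexp_mul_I : ContDiff ℝ ∞ (fun t : ℝ => Complex.exp (t * Complex.I)) :=
  (Complex.ofRealCLM.contDiff.mul contDiff_const).cexp

theorem norm_iteratedFDeriv_cexp_phase_le (ξ : Lattice n) (k : ℕ) (y : Fin n → ℝ) :
    ‖iteratedFDeriv ℝ k (fun y => Complex.exp (phase ξ y * Complex.I)) y‖ ≤
      (2 * Real.pi * n * jb ξ) ^ k := by
  have e : (fun y => Complex.exp (phase ξ y * Complex.I)) =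
      (fun t : ℝ => Complex.exp (t * Complex.I)) ∘ phase ξ := rfl
  rw [e, ContinuousLinearMap.iteratedFDeriv_comp_right (n := ∞) _ contDiff_cexp_mul_I y
    (by exact_mod_cast le_top)]
  refine (ContinuousMultilinearMap.norm_compContinuousLinearMap_le _ _).trans ?_
  rw [norm_iteratedFDeriv_eq_norm_iteratedDeriv, iteratedDeriv_cexp_mul_I, norm_mul, norm_pow,
    Complex.norm_I, one_pow, Complex.norm_exp_ofReal_mul_I, one_mul, one_mul, Finset.prod_const,
    Finset.card_univ, Fintype.card_fin]
  exact pow_le_pow_left₀ (norm_nonneg _) (norm_phase_le ξ) k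

theorem RapidDecay.summable_jb_pow_mul {c : Lattice n → ℂ} (hc : RapidDecay c) (N : ℕ) :
    Summable fun ξ => jb ξ ^ N * ‖c ξ‖ := by
  obtain ⟨C, hC⟩ := rapidDecay_iff.mp hc (2 * n + N)
  refine (summable_inv_jb_pow.mul_left C).of_nonneg_of_le
    (fun ξ => by have := jb_pos ξ; positivity) fun ξ => ?_
  refine norm_le_of_jb_pow_mul_le ?_
  rw [← mul_assoc, ← pow_add]
  exact hC ξ

/-- Each derivative of an exponential costs a factor `O(jb ξ)`, which rapid decay absorbs, so the
series may be differentiated termwise. -/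
theorem torusSmooth_fourierSum {c : Lattice n → ℂ} (hc : RapidDecay c) :
    TorusSmooth (fourierSum c) := by
  unfold TorusSmooth fourierSum
  simp only [mFourier_coe]
  have hsm : ∀ ξ : Lattice n, ContDiff ℝ ∞ fun y => Complex.exp (phase ξ y * Complex.I) :=
    fun ξ => contDiff_cexp_mul_I.comp (phase ξ).contDiff
  refine contDiff_tsum (N := ⊤)
    (v := fun k ξ => (2 * Real.pi * n) ^ k * (jb ξ ^ k * ‖c ξ‖))
    (fun ξ => contDiff_const.mul (hsm ξ))
    (fun k _ => (hc.summable_jb_pow_mul k).mul_left _) fun k ξ y _ => ?_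
  have h : ‖iteratedFDeriv ℝ k (fun y => c ξ • Complex.exp (phase ξ y * Complex.I)) y‖ =
      ‖c ξ‖ * ‖iteratedFDeriv ℝ k (fun y => Complex.exp (phase ξ y * Complex.I)) y‖ := by
    rw [iteratedFDeriv_const_smul_apply' ((hsm ξ).of_le (by exact_mod_cast le_top)).contDiffAt,
      norm_smul]
  simp only [smul_eq_mul] at h
  rw [h]
  calc _ ≤ ‖c ξ‖ * (2 * Real.pi * n * jb ξ) ^ k := by
        gcongr
        exact norm_iteratedFDeriv_cexp_phase_le ξ k y
    _ = _ := by
        rw [mul_pow]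
        ring

theorem coef_fourierSum {c : Lattice n → ℂ} (hc : RapidDecay c) (ξ : Lattice n) :
    coef (fourierSum c) ξ = c ξ := by
  have hn : ∀ η x, ‖UnitAddTorus.mFourier (-ξ) x * (c η * UnitAddTorus.mFourier η x)‖ = ‖c η‖ := by
    intro η x
    rw [norm_mul, norm_mul, norm_mFourier_apply, norm_mFourier_apply, one_mul, mul_one]
  have h := hasSum_integral_of_summable_integral_norm (μ := torusMeasure n)
    (F := fun η x => UnitAddTorus.mFourier (-ξ) x * (c η * UnitAddTorus.mFourier η x))
    (fun η => integrable_mFourier_mul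
      (continuous_const.mul (UnitAddTorus.mFourier η).continuous) _)
    (by simp only [hn]; simpa using hc.summable_norm)
  have h1 : ∀ η, ∫ x, UnitAddTorus.mFourier (-ξ) x * (c η * UnitAddTorus.mFourier η x)
      ∂(torusMeasure n) = if η = ξ then c ξ else 0 := by
    intro η
    have := (coef_const_mul (c η) (UnitAddTorus.mFourier η) ξ)
    rw [coef_mFourier] at this
    rw [coef] at this
    rw [this]
    by_cases h : η = ξ
    · simp [h]
    · simp [h, Ne.symm h]
  simp only [h1, tsum_mul_left] at h
  exact h.unique (hasSum_ite_eq ξ (c ξ))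

theorem coef_conj (u : Torus n → ℂ) (ξ : Lattice n) :
    coef (fun x => conj (u x)) ξ = conj (coef u (-ξ)) := by
  rw [coef, coef, ← integral_conj]
  congr 1
  funext x
  rw [map_mul, ← UnitAddTorus.mFourier_neg, neg_neg]

end FourierSum

/-! ### From symbols to coefficients and back; the adjoint symbol. -/

section Symbols

variable {n : ℕ} {Λ : Lattice n → ℝ} {ρ m μ : ℝ}

theorem coef_diff {τ : Symb n} (hτ : ∀ k, TorusSmooth (τ k)) (α : MultiIdx n) (k : Lattice n) :
    coef (diff α τ k) = diff α (fun l => coef (τ l)) k :=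
  map_diff (P := TorusSmooth) (fun _ _ => TorusSmooth.sub) (L := coef)
    (fun _ _ hu hv => funext fun ξ => coef_sub hu.continuous hv.continuous ξ) α hτ k

theorem torusSmooth_diff {τ : Symb n} (hτ : ∀ k, TorusSmooth (τ k)) (α : MultiIdx n)
    (k : Lattice n) : TorusSmooth (diff α τ k) :=
  diff_mem (fun _ _ => TorusSmooth.sub) α hτ k

theorem SymbolS.coefS {τ : Symb n} (h : SymbolS Λ ρ m τ) : CoefS Λ ρ m (fun k => coef (τ k)) := by
  intro α N
  obtain ⟨C, hC⟩ := exists_jb_pow_mul_le (b := fun k => coef (diff α τ k))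
    (w := fun k => Λ k ^ (m - ρ * (α.order : ℝ))) (fun β => by
      obtain ⟨C, _, hC⟩ := h.2 α β
      refine ⟨C, fun k ξ => ?_⟩
      rw [← (torusSmooth_diff h.1 α k).coef_dFall]
      exact norm_coef_le (hC k) ξ) N 0
  refine ⟨C, fun k ξ => ?_⟩
  have := hC k ξ
  rwa [fall_zero, one_mul, coef_diff h.1] at this

/-- Decay of order `2 * n + β.order` makes the Fourier series of the derivative absolutely
convergent, with a sum controlled uniformly in `k` by the weight. -/
theorem CoefS.symbolS {τ : Symb n} (hΛ : IsWeight μ Λ) (hτ : ∀ k, TorusSmooth (τ k))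
    (h : CoefS Λ ρ m (fun k => coef (τ k))) : SymbolS Λ ρ m τ := by
  refine ⟨hτ, fun α β => ?_⟩
  obtain ⟨A, hA0, hA⟩ := exists_norm_fall_le β
  obtain ⟨C, hC⟩ := h α (2 * n + β.order)
  set S := ∑' ξ : Lattice n, (jb ξ ^ (2 * n))⁻¹
  have hS : 0 ≤ S := tsum_nonneg fun ξ => by have := jb_pos ξ; positivity
  -- The summand `1` only makes the constant strictly positive.
  refine ⟨A * |C| * S + 1, by positivity, fun k x => ?_⟩
  have hsm := torusSmooth_diff hτ α k
  have hk := hΛ.pos k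
  set W := Λ k ^ (m - ρ * (α.order : ℝ))
  have hW : 0 ≤ W := by positivity
  have hb : ∀ ξ, ‖coef (dFall β (diff α τ k)) ξ‖ ≤ A * |C| * W * (jb ξ ^ (2 * n))⁻¹ := by
    intro ξ
    have hj := jb_pos ξ
    rw [hsm.coef_dFall, norm_mul, coef_diff hτ]
    refine norm_le_of_jb_pow_mul_le ?_
    calc jb ξ ^ (2 * n) * (‖fall β ξ‖ * ‖diff α (fun l => coef (τ l)) k ξ‖)
        ≤ jb ξ ^ (2 * n) * ((A * jb ξ ^ β.order) * ‖diff α (fun l => coef (τ l)) k ξ‖) := by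
          gcongr
          exact hA ξ
      _ = A * (jb ξ ^ (2 * n + β.order) * ‖diff α (fun l => coef (τ l)) k ξ‖) := by
          rw [pow_add]
          ring
      _ ≤ A * (|C| * W) := by
          refine mul_le_mul_of_nonneg_left ((hC k ξ).trans ?_) hA0
          gcongr
          exact le_abs_self C
      _ = _ := by ring
  calc ‖dFall β (diff α τ k) x‖ ≤ ∑' ξ, ‖coef (dFall β (diff α τ k)) ξ‖ :=
        (hsm.dFall β).norm_le_tsum x
    _ ≤ ∑' ξ, A * |C| * W * (jb ξ ^ (2 * n))⁻¹ :=
        (hsm.dFall β).rapidDecay_coef.summable_norm.tsum_le_tsum hb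
          (summable_inv_jb_pow.mul_left _)
    _ = A * |C| * W * S := tsum_mul_left
    _ ≤ _ := by nlinarith

theorem coef_monomial_mul_diff {σ : Symb n} (hσ : ∀ k, TorusSmooth (σ k)) (s : Finset (Fin n)) :
    (fun k => coef (fun x => (monomial (ind s) k : ℂ) * diff (ind s) σ k x)) =
      cmul s (diff (ind s) (fun k => coef (σ k))) := by
  funext k ξ
  rw [coef_const_mul]
  rw [coef_diff hσ]
  rfl

theorem SymbolM.coefM {σ : Symb n} (hΛ : IsWeight μ Λ) (hρ : 0 < ρ) (h : SymbolM Λ ρ m σ) :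
    CoefM Λ ρ m (fun k => coef (σ k)) := by
  refine CoefM.of_coefS hΛ hρ fun s => ?_
  rw [← coef_monomial_mul_diff h.1]
  exact (h.2 (ind s) (isZeroOne_ind s)).coefS

theorem CoefM.symbolM {σ : Symb n} (hΛ : IsWeight μ Λ) (hρ : 0 < ρ) (hσ : ∀ k, TorusSmooth (σ k))
    (h : CoefM Λ ρ m (fun k => coef (σ k))) : SymbolM Λ ρ m σ := by
  refine ⟨hσ, fun γ hγ => ?_⟩
  obtain ⟨s, rfl⟩ := exists_ind_eq hγ
  refine CoefS.symbolS hΛ (fun k => (torusSmooth_diff hσ _ k).const_mul _) ?_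
  rw [coef_monomial_mul_diff hσ]
  exact h.coefS hΛ hρ s

theorem CoefM.rapidDecay {b : Coef n} (h : CoefM Λ ρ m b) (k : Lattice n) : RapidDecay (b k) := by
  refine rapidDecay_iff.mpr fun N => ?_
  obtain ⟨C, hC⟩ := h ∅ 0 N
  exact ⟨_, fun ξ => by simpa [cmul, monomial] using hC k ξ⟩

/-- Passing from a symbol to its complex conjugate, on Fourier coefficients. -/
def conjCoef (b : Coef n) : Coef n := fun k ξ => conj (b k (-ξ))

theorem CoefM.conjCoef {b : Coef n} (h : CoefM Λ ρ m b) : CoefM Λ ρ m (conjCoef b) := by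
  intro s α N
  obtain ⟨C, hC⟩ := h s α N
  refine ⟨C, fun k ξ => ?_⟩
  have e : cmul s (diff (α + ind s) (LatticePDO.conjCoef b)) k ξ =
      conj (cmul s (diff (α + ind s) b) k (-ξ)) := by
    have := map_diff' (L := fun (v : Lattice n → ℂ) ξ => conj (v (-ξ)))
      (fun u v => by funext ξ; simp) (α + ind s) b k
    simp only [cmul, map_mul, map_intCast]
    congr 1
    exact (congrFun this ξ).symm
  rw [e, RCLike.norm_conj, ← jb_neg ξ]
  exact hC k (-ξ)

/-- The symbol of the formal adjoint of `T_σ`. -/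
def adjointSymbol (σ : Symb n) : Symb n :=
  fun k => fourierSum (taylorCoef 0 (conjCoef fun l => coef (σ l)) k)

/-- At order `0` the Newton polynomial is empty, so one estimate covers both the adjoint symbol and
its expansion errors. -/
theorem taylorCoef_zero (b : Coef n) (k ξ : Lattice n) : taylorCoef 0 b k ξ = b (k + ξ) ξ :=
  taylorRem_zero_order _ k ξ

theorem SymbolM.coefM_taylorCoef {σ : Symb n} (hΛ : IsWeight μ Λ) (hρ : 0 < ρ)
    (h : SymbolM Λ ρ m σ) (N : ℕ) :
    CoefM Λ ρ (m - ρ * (N : ℝ)) (taylorCoef N (LatticePDO.conjCoef fun l => coef (σ l))) :=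
  ((h.coefM hΛ hρ).conjCoef).taylorCoef hΛ hρ N

theorem SymbolM.coef_adjointSymbol {σ : Symb n} (hΛ : IsWeight μ Λ) (hρ : 0 < ρ)
    (h : SymbolM Λ ρ m σ) (k ξ : Lattice n) :
    coef (adjointSymbol σ k) ξ = conj (coef (σ (k + ξ)) (-ξ)) := by
  rw [adjointSymbol, coef_fourierSum ((h.coefM_taylorCoef hΛ hρ 0).rapidDecay k), taylorCoef_zero]
  rfl

theorem SymbolM.torusSmooth_adjointSymbol {σ : Symb n} (hΛ : IsWeight μ Λ) (hρ : 0 < ρ)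
    (h : SymbolM Λ ρ m σ) (k : Lattice n) : TorusSmooth (adjointSymbol σ k) :=
  torusSmooth_fourierSum ((h.coefM_taylorCoef hΛ hρ 0).rapidDecay k)

theorem torusSmooth_expansion_term {σ : Symb n} (hσ : ∀ k, TorusSmooth (σ k)) (k : Lattice n)
    (α : MultiIdx n) : TorusSmooth (fun x => (1 / (α.fact : ℂ)) *
      diff α (fun l => dFall α (fun y => conj (σ l y))) k x) :=
  (torusSmooth_diff (fun l => (hσ l).conj.dFall α) α k).const_mul _

theorem torusSmooth_adjointExpansion {σ : Symb n} (hσ : ∀ k, TorusSmooth (σ k)) (N : ℕ)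
    (k : Lattice n) : TorusSmooth (adjointExpansion σ N k) :=
  TorusSmooth.sum _ fun α => torusSmooth_expansion_term hσ k α

/-- On coefficients `D_x^{(α)} / α!` becomes multiplication by `binom α ξ`, which turns the
expansion into a Newton polynomial. -/
theorem coef_adjointExpansion {σ : Symb n} (hσ : ∀ k, TorusSmooth (σ k)) (N : ℕ)
    (k ξ : Lattice n) : coef (adjointExpansion σ N k) ξ =
      ∑ β ∈ idx n N, binom β ξ * diff β (fun l => conjCoef (fun l => coef (σ l)) l ξ) k := by
  have h := coef_sum (idx n N) (fun α => (torusSmooth_expansion_term hσ k α).continuous) ξ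
  refine h.trans (Finset.sum_congr rfl fun α _ => ?_)
  rw [coef_const_mul]
  rw [coef_diff fun l => (hσ l).conj.dFall α, diff_apply, binom, mul_assoc,
    ← diff_const_mul α (fall α ξ)]
  congr 2
  funext l
  rw [(hσ l).conj.coef_dFall, coef_conj]
  rfl

theorem SymbolM.adjointSymbol_sub_expansion {σ : Symb n} (hΛ : IsWeight μ Λ) (hρ : 0 < ρ)
    (h : SymbolM Λ ρ m σ) (N : ℕ) :
    SymbolM Λ ρ (m - ρ * (N : ℝ)) (fun k x => adjointSymbol σ k x - adjointExpansion σ N k x) := by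
  have h1 := h.torusSmooth_adjointSymbol hΛ hρ
  have h2 := torusSmooth_adjointExpansion h.1 N
  refine CoefM.symbolM hΛ hρ (fun k => (h1 k).sub (h2 k)) ?_
  convert h.coefM_taylorCoef hΛ hρ N using 1
  funext k ξ
  refine (coef_sub (h1 k).continuous (h2 k).continuous ξ).trans ?_
  rw [h.coef_adjointSymbol hΛ hρ, coef_adjointExpansion h.1]
  rfl

theorem SymbolM.symbolM_adjointSymbol {σ : Symb n} (hΛ : IsWeight μ Λ) (hρ : 0 < ρ)
    (h : SymbolM Λ ρ m σ) : SymbolM Λ ρ m (adjointSymbol σ) := by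
  have := h.adjointSymbol_sub_expansion hΛ hρ 0
  simpa [adjointExpansion] using this

end Symbols

end

/-! ### The operators as infinite matrices; adjointness. -/

noncomputable section

section Pdo

variable {n : ℕ}

/-- Integration against `v` is the `L²` inner product with `conj v`, a continuous functional, so it
may be applied termwise to the `L²`-convergent series. -/
theorem hasSum_integral_mul_mFourierBasis_symm {v : Torus n → ℂ} (hv : Continuous v)
    (f : L2Lattice n) :
    HasSum (fun l => f l * ∫ x, v x * UnitAddTorus.mFourier l x ∂(torusMeasure n))
      (∫ x, v x * (UnitAddTorus.mFourierBasis (d := Fin n)).repr.symm f x ∂(torusMeasure n)) := by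
  let F : Lp ℂ 2 (torusMeasure n) := (UnitAddTorus.mFourierBasis (d := Fin n)).repr.symm f
  let g : C(Torus n, ℂ) := ⟨fun x => conj (v x), hv.star⟩
  let G : Lp ℂ 2 (torusMeasure n) := ContinuousMap.toLp (E := ℂ) 2 (torusMeasure n) ℂ g
  have hinner : ∀ H : Lp ℂ 2 (torusMeasure n), inner ℂ G H = ∫ x, v x * H x ∂(torusMeasure n) := by
    intro H
    rw [L2.inner_def]
    refine integral_congr_ae ?_
    filter_upwards [ContinuousMap.coeFn_toLp (p := 2) (𝕜 := ℂ) (torusMeasure n) g] with x hx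
    rw [RCLike.inner_apply, hx]
    simp [g, mul_comm]
  let a : Lattice n → ℂ := fun l => f l
  let e : Lattice n → Lp ℂ 2 (torusMeasure n) :=
    fun l => ContinuousMap.toLp (E := ℂ) 2 (torusMeasure n) ℂ (UnitAddTorus.mFourier l)
  have h1 : HasSum (fun l => a l • e l) F := by
    have := UnitAddTorus.mFourierBasis.hasSum_repr_symm f
    rwa [UnitAddTorus.coe_mFourierBasis] at this
  have h2 := h1.mapL (innerSL ℂ G)
  have h3 : ∀ l, inner ℂ G (e l) = ∫ x, v x * UnitAddTorus.mFourier l x ∂(torusMeasure n) := by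
    intro l
    rw [hinner]
    refine integral_congr_ae ?_
    filter_upwards [ContinuousMap.coeFn_toLp (p := 2) (𝕜 := ℂ) (torusMeasure n)
      (UnitAddTorus.mFourier l)] with x hx
    rw [hx]
  simp only [innerSL_apply_apply, inner_smul_right, h3] at h2
  exact (hinner F) ▸ h2

/-- This identifies the matrix of the operator on all of `ℓ²`. The substitution `x ↦ -x` undoes the
reflection in `latticeFourier`. -/
theorem hasSum_pdo {σ : Symb n} {k : Lattice n} (hσ : Continuous (σ k)) (f : L2Lattice n) :
    HasSum (fun l => coef (σ k) (l - k) * f l) (pdo σ f k) := by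
  have h := hasSum_integral_mul_mFourierBasis_symm
    (v := fun x => UnitAddTorus.mFourier k (-x) * σ k (-x))
    (((UnitAddTorus.mFourier k).continuous.comp continuous_neg).mul (hσ.comp continuous_neg)) f
  rw [← integral_neg_eq_self] at h
  simp only [neg_neg] at h
  change HasSum _ (pdo σ f k) at h
  convert h using 2 with l
  rw [mul_comm, ← integral_neg_eq_self, coef]
  congr 2
  funext x
  rw [neg_neg, mFourier_neg_apply, neg_sub, sub_eq_add_neg, UnitAddTorus.mFourier_add]
  ring

/-- An infinite matrix with rapid decay away from the diagonal and at most polynomial growth along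
it. -/
def OffDiagonalDecay (A : Lattice n → Lattice n → ℂ) : Prop :=
  ∃ M : ℕ, ∀ N : ℕ, ∃ C : ℝ, 0 ≤ C ∧ ∀ k l, jb (l - k) ^ N * ‖A k l‖ ≤ C * jb k ^ M

/-- Since `jb k ≤ jb l * jb (l - k)`, off-diagonal decay of order `P + M` trades growth in the row
index for growth in the column index, which a rapidly decreasing `f` can absorb. -/
theorem OffDiagonalDecay.exists_weighted_le {A : Lattice n → Lattice n → ℂ}
    (hA : OffDiagonalDecay A) (P : ℕ) :
    ∃ (C : ℝ) (Q : ℕ), 0 ≤ C ∧ ∀ k l, jb k ^ P * ‖A k l‖ ≤ C * jb l ^ Q := by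
  obtain ⟨M, hM⟩ := hA
  obtain ⟨C, hC0, hC⟩ := hM (P + M)
  refine ⟨C, P + M, hC0, fun k l => ?_⟩
  have hk := jb_pos k
  have hl := jb_pos l
  have h1 : jb k ^ (P + M) ≤ (jb l * jb (l - k)) ^ (P + M) := by
    rw [jb_sub_comm]
    exact pow_le_pow_left₀ hk.le (jb_le_mul_sub k l) _
  refine le_of_mul_le_mul_left ?_ (pow_pos hk M)
  calc jb k ^ M * (jb k ^ P * ‖A k l‖) = jb k ^ (P + M) * ‖A k l‖ := by
        rw [pow_add]
        ring
    _ ≤ (jb l * jb (l - k)) ^ (P + M) * ‖A k l‖ := by gcongr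
    _ = jb l ^ (P + M) * (jb (l - k) ^ (P + M) * ‖A k l‖) := by
        rw [mul_pow]
        ring
    _ ≤ jb l ^ (P + M) * (C * jb k ^ M) := mul_le_mul_of_nonneg_left (hC k l) (by positivity)
    _ = _ := by ring

theorem OffDiagonalDecay.rapidDecay {A : Lattice n → Lattice n → ℂ} (hA : OffDiagonalDecay A)
    {f : Lattice n → ℂ} (hf : RapidDecay f) {u : Lattice n → ℂ}
    (hu : ∀ k, HasSum (fun l => A k l * f l) (u k)) : RapidDecay u := by
  refine rapidDecay_iff.mpr fun P => ?_
  obtain ⟨C, Q, hC0, hC⟩ := hA.exists_weighted_le P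
  have hsum := hf.summable_jb_pow_mul Q
  refine ⟨C * ∑' l, jb l ^ Q * ‖f l‖, fun k => ?_⟩
  have hk := jb_pos k
  have hterm : ∀ l, ‖A k l * f l‖ ≤ (jb k ^ P)⁻¹ * C * (jb l ^ Q * ‖f l‖) := by
    intro l
    rw [norm_mul]
    calc ‖A k l‖ * ‖f l‖ = (jb k ^ P)⁻¹ * (jb k ^ P * ‖A k l‖) * ‖f l‖ := by
          rw [inv_mul_cancel_left₀ (by positivity)]
      _ ≤ (jb k ^ P)⁻¹ * (C * jb l ^ Q) * ‖f l‖ := by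
          refine mul_le_mul_of_nonneg_right ?_ (norm_nonneg _)
          exact mul_le_mul_of_nonneg_left (hC k l) (by positivity)
      _ = _ := by ring
  have h1 : ‖u k‖ ≤ (jb k ^ P)⁻¹ * C * ∑' l, jb l ^ Q * ‖f l‖ := by
    rw [← (hu k).tsum_eq, ← tsum_mul_left]
    exact tsum_of_norm_bounded (hsum.mul_left _).hasSum hterm
  calc jb k ^ P * ‖u k‖ ≤ jb k ^ P * ((jb k ^ P)⁻¹ * C * ∑' l, jb l ^ Q * ‖f l‖) := by gcongr
    _ = _ := by
      rw [← mul_assoc, ← mul_assoc, mul_inv_cancel₀ (by positivity), one_mul]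

/-- Decay of order `2 * n` in the row index makes the double sum absolutely convergent for bounded
`g`, so the summations may be exchanged. -/
theorem OffDiagonalDecay.l2Pairing_eq {A : Lattice n → Lattice n → ℂ} (hA : OffDiagonalDecay A)
    {f g u v : Lattice n → ℂ} (hf : RapidDecay f) {B : ℝ} (hg : ∀ k, ‖g k‖ ≤ B)
    (hu : ∀ k, HasSum (fun l => A k l * f l) (u k))
    (hv : ∀ l, HasSum (fun k => conj (A k l) * g k) (v l)) : l2Pairing u g = l2Pairing f v := by
  obtain ⟨C, Q, hC0, hC⟩ := hA.exists_weighted_le (2 * n)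
  have hB : 0 ≤ B := (norm_nonneg _).trans (hg 0)
  have hs : Summable fun p : Lattice n × Lattice n => A p.1 p.2 * f p.2 * conj (g p.1) := by
    have h1 := (summable_inv_jb_pow (n := n)).mul_of_nonneg (hf.summable_jb_pow_mul Q)
      (fun k => by have := jb_pos k; positivity) (fun k => by have := jb_pos k; positivity)
    refine (h1.mul_left (C * B)).of_norm_bounded fun p => ?_
    have hk := jb_pos p.1
    have hA' : ‖A p.1 p.2‖ ≤ C * jb p.2 ^ Q * (jb p.1 ^ (2 * n))⁻¹ :=
      norm_le_of_jb_pow_mul_le (hC p.1 p.2)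
    have hl := jb_pos p.2
    rw [norm_mul, norm_mul, RCLike.norm_conj]
    calc ‖A p.1 p.2‖ * ‖f p.2‖ * ‖g p.1‖
        ≤ C * jb p.2 ^ Q * (jb p.1 ^ (2 * n))⁻¹ * ‖f p.2‖ * B := by
          gcongr
          exact hg _
      _ = _ := by ring
  have e1 : ∀ k, u k * conj (g k) = ∑' l, A k l * f l * conj (g k) :=
    fun k => ((hu k).mul_right _).tsum_eq.symm
  have e2 : ∀ l, f l * conj (v l) = ∑' k, A k l * f l * conj (g k) := by
    intro l
    have h := ((Complex.conjCLE.toContinuousLinearMap.hasSum (hv l)).mul_left (f l)).tsum_eq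
    refine Eq.trans ?_ (h.symm.trans (tsum_congr fun k => ?_))
    · rfl
    · simp
      ring
  unfold l2Pairing
  simp only [e1, e2]
  exact (hs.tsum_comm (f := fun k l => A k l * f l * conj (g k))).symm

variable {Λ : Lattice n → ℝ} {ρ m μ : ℝ}

theorem SymbolM.offDiagonalDecay {σ : Symb n} (hΛ : IsWeight μ Λ) (hρ : 0 < ρ)
    (h : SymbolM Λ ρ m σ) : OffDiagonalDecay fun k l => coef (σ k) (l - k) := by
  obtain ⟨K, M, hK, hM⟩ := hΛ.exists_rpow_shift_le m
  -- Temperateness with base point `0` bounds `Λ k ^ m` by a power of `jb k`, whatever the sign of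
  -- `m`.
  have h0 : 0 < Λ 0 ^ m := Real.rpow_pos_of_pos (hΛ.pos 0) _
  refine ⟨M, fun N => ?_⟩
  obtain ⟨C, hC⟩ := h.coefM hΛ hρ ∅ 0 N
  refine ⟨|C| * (K * Λ 0 ^ m), by positivity, fun k l => ?_⟩
  have h1 : jb (l - k) ^ N * ‖coef (σ k) (l - k)‖ ≤ C * Λ k ^ m := by
    simpa [cmul, monomial] using hC k (l - k)
  have h2 := hM 0 k
  rw [zero_add] at h2
  have h3 := hΛ.pos k
  calc _ ≤ C * Λ k ^ m := h1
    _ ≤ |C| * Λ k ^ m := by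
        gcongr
        exact le_abs_self C
    _ ≤ |C| * (K * Λ 0 ^ m * jb k ^ M) := by gcongr
    _ = _ := by ring

theorem SymbolM.rapidDecay_pdo {σ : Symb n} (hΛ : IsWeight μ Λ) (hρ : 0 < ρ)
    (h : SymbolM Λ ρ m σ) {f : L2Lattice n} (hf : RapidDecay f) : RapidDecay (pdo σ f) :=
  (h.offDiagonalDecay hΛ hρ).rapidDecay hf fun k => hasSum_pdo (h.1 k).continuous f

theorem SymbolM.l2Pairing_pdo {σ : Symb n} (hΛ : IsWeight μ Λ) (hρ : 0 < ρ)
    (h : SymbolM Λ ρ m σ) {f : L2Lattice n} (hf : RapidDecay f) (g : L2Lattice n) :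
    l2Pairing (pdo σ f) g = l2Pairing f (pdo (adjointSymbol σ) g) := by
  refine (h.offDiagonalDecay hΛ hρ).l2Pairing_eq hf (B := ‖g‖)
    (lp.norm_apply_le_norm two_ne_zero g) (fun k => hasSum_pdo (h.1 k).continuous f) fun l => ?_
  have h1 := hasSum_pdo (h.torusSmooth_adjointSymbol hΛ hρ l).continuous g
  -- The entry of the adjoint symbol at `(l, k)` is the coefficient with `ξ = k - l`, and `l + ξ =
  -- k`: the conjugate transpose.
  simpa only [h.coef_adjointSymbol hΛ hρ, add_sub_cancel, neg_sub] using h1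

theorem rapidDecay_lp_single (l : Lattice n) :
    RapidDecay (lp.single 2 l (1 : ℂ) : L2Lattice n) := by
  refine rapidDecay_iff.mpr fun N => ⟨jb l ^ N, fun k => ?_⟩
  rcases eq_or_ne k l with rfl | h
  · simp
  · have := jb_pos l
    simp [Pi.single_eq_of_ne h]
    positivity

theorem l2Pairing_lp_single (l : Lattice n) (v : Lattice n → ℂ) :
    l2Pairing (lp.single 2 l (1 : ℂ) : L2Lattice n) v = conj (v l) := by
  rw [l2Pairing, tsum_eq_single l]
  · simp
  · intro k hk
    simp [Pi.single_eq_of_ne hk]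

/-- Point masses are rapidly decreasing, and pairing with them recovers every value. Conversely, the
pairing identity needs no decay of `g`. -/
theorem SymbolM.isAdjointValue_iff {σ : Symb n} (hΛ : IsWeight μ Λ) (hρ : 0 < ρ)
    (h : SymbolM Λ ρ m σ) (g k : L2Lattice n) :
    IsAdjointValue σ g k ↔ pdo (adjointSymbol σ) g = k := by
  constructor
  · intro hg
    funext l
    have h1 := hg _ (rapidDecay_lp_single l)
    rw [h.l2Pairing_pdo hΛ hρ (rapidDecay_lp_single l), l2Pairing_lp_single,
      l2Pairing_lp_single] at h1
    exact (starRingEnd ℂ).injective h1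
  · intro hg f hf
    rw [h.l2Pairing_pdo hΛ hρ hf, hg]

end Pdo

end

end LatticePDO

theorem mainTheorem7 (n : ℕ) (Λ : LatticePDO.Lattice n → ℝ) (μ : ℝ)
    (hΛ : LatticePDO.IsWeight μ Λ) (ρ : ℝ) (hρ : 0 < ρ) (hρμ : ρ ≤ 1 / μ) (m : ℝ)
    (σ : LatticePDO.Symb n) (hσ : LatticePDO.SymbolM Λ ρ m σ) :
    ∃ σstar : LatticePDO.Symb n,
      LatticePDO.SymbolM Λ ρ m σstar ∧
      -- both operators map the Schwartz space into itself, hence into `ℓ²`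
      (∀ f : LatticePDO.L2Lattice n, LatticePDO.RapidDecay f →
        LatticePDO.RapidDecay (LatticePDO.pdo σ f) ∧
        LatticePDO.RapidDecay (LatticePDO.pdo σstar f)) ∧
      -- `g ∈ Dom(T_σ^*)` and `T_σ^* g = h` if and only if `T_{σ*} g = h`
      (∀ g h : LatticePDO.L2Lattice n,
        LatticePDO.IsAdjointValue σ g h ↔ LatticePDO.pdo σstar g = h) ∧
      (∀ f g : LatticePDO.L2Lattice n, LatticePDO.RapidDecay f → LatticePDO.RapidDecay g →
        LatticePDO.l2Pairing (LatticePDO.pdo σ f) g =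
          LatticePDO.l2Pairing f (LatticePDO.pdo σstar g)) ∧
      -- the asymptotic expansion
      (∀ N : ℕ, LatticePDO.SymbolM Λ ρ (m - ρ * (N : ℝ))
        (fun k x => σstar k x - LatticePDO.adjointExpansion σ N k x)) := by
  have hstar := hσ.symbolM_adjointSymbol hΛ hρ
  exact ⟨LatticePDO.adjointSymbol σ, hstar,
    fun f hf => ⟨hσ.rapidDecay_pdo hΛ hρ hf, hstar.rapidDecay_pdo hΛ hρ hf⟩,
    hσ.isAdjointValue_iff hΛ hρ, fun f g hf _ => hσ.l2Pairing_pdo hΛ hρ hf g,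
    hσ.adjointSymbol_sub_expansion hΛ hρ⟩
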